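/- **Setting.** Let $\Omega\subset\mathbb R^2$ be a bounded connected open set with Lipschitz boundary, and let $\Gamma\subset\partial\Omega$ be a Borel set with $\mathcal H^1(\Gamma)>0$. Let $h>0$, $E>0$, $-1<\nu<\tfrac12$. Let $\mathbf f\in L^2(\partial\Omega,\mathbb R^2)$ be equilibrated, i.e. $\int_{\partial\Omega}\mathbf f\cdot\mathbf z\,d\mathcal H^1=0$ for every $\mathbf z\in H^1(\Omega,\mathbb R^2)$ with $\mathbb E(\mathbf z)=0$, where $\mathbb E(\mathbf u)=\tfrac12(D\mathbf u+D\mathbf u^T)$; boundary values are traces. For symmetric $2\times2$ matrices put $$J(\mathbb A)=\frac{E}{2(1+\nu)}|\mathbb A|^2+\frac{E\nu}{2(1-\nu^2)}|\mathrm{Tr}\,\mathbb A|^2,\qquad J'(\mathbb A)=\frac{E}{1+\nu}\mathbb A+\frac{E\nu}{1-\nu^2}(\mathrm{Tr}\,\mathbb A)\,\mathbb I .$$ Let $\mathcal A^0=\{w\in H^2(\Omega): w=\partial w/\partial\mathbf n=0\text{ on }\Gamma\}$, $\mathcal A^1=\{w\in H^2(\Omega): w=0\text{ on }\Gamma\}$,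 $\mathcal A^2=H^2(\Omega)$, and fix $i\in\{0,1,2\}$. For $\mathbf u\in H^1(\Omega,\mathbb R^2)$ and $w\in H^2(\Omega)$ let $$F^b_h(w)=\frac{h^3}{12}\int_\Omega J(D^2w)\,d\mathbf x,\qquad \mathcal F_h(\mathbf u,w)=h\int_\Omega J\big(\mathbb E(\mathbf u)+\tfrac12 Dw\otimes Dw\big)\,d\mathbf x+F^b_h(w)-h\int_{\partial\Omega}\mathbf f\cdot\mathbf u\,d\mathcal H^1 ,$$ let $\mathcal F^i_h=\mathcal F_h$ if $w\in\mathcal A^i$ and $\mathcal F_h^i=+\infty$ otherwise, let $\mathcal F_{h,0}(\mathbf u)=\mathcal F_h(\mathbf u,0)$, and for $\varepsilon>0$ let $$\mathcal E^i_{h,\varepsilon}(\mathbf u,w)=\varepsilon^{-2}\Big(\mathcal F^i_h(\mathbf u,\varepsilon w)-\min_{H^1(\Omega,\mathbb R^2)}\mathcal F_{h,0}\Big).$$ Let $$\mathcal E^i_h(\mathbf u,w)=F^b_h(w)+\frac h2\int_\Omega J'(\mathbb E(\mathbf u)):Dw\otimes Dw\,d\mathbf x$$ if $\mathbf u$ minimizes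 $\mathcal F_{h,0}$ over $H^1(\Omega,\mathbb R^2)$ and $w\in\mathcal A^i$, and $\mathcal E^i_h(\mathbf u,w)=+\infty$ otherwise. Given $C^1$ functionals $\mathcal I_\varepsilon:X\to\mathbb R$ $(\varepsilon>0)$ on a Banach space $X$, a family $(x_\varepsilon)$ in $X$ is a *uniform Palais–Smale sequence* if there is $C>0$ with $\mathcal I_\varepsilon(x_\varepsilon)\le C$ for all $\varepsilon\in(0,1]$, and $\|\mathcal I_\varepsilon'(x_\varepsilon)\|_{X^*}\to0$ as $\varepsilon\to0_+$. **Theorem.** Let $\mathbf u_*$ minimize $\mathcal F_{h,0}$ over $H^1(\Omega,\mathbb R^2)$, let $w\in\mathcal A^i$ be a critical point of $\mathcal E^i_h(\mathbf u_*,\cdot)$ on $\mathcal A^i$, and let $\mathbf z_w$ minimize $$\mathcal Q_w(\mathbf z)=\int_\Omega J\big(\mathbb E(\mathbf z)+\tfrac12Dw\otimes Dw\big)\,d\mathbf x$$ over $H^1(\Omega,\mathbb R^2)$. Then the functionals $\mathcal E^i_{h,\varepsilon}$, $\varepsilon>0$, are $C^1$ on $X=H^1(\Omega,\mathbb R^2)\times\mathcal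 A^i$, the family $(\mathbf u_*+\varepsilon^2\mathbf z_w,\,w)$ is a uniform Palais–Smale sequence for them in $X$, and $$\lim_{\varepsilon\to0_+}\mathcal E^i_{h,\varepsilon}(\mathbf u_*+\varepsilon^2\mathbf z_w,w)=\mathcal E^i_h(\mathbf u_*,w).$$ -/

import Mathlib

open MeasureTheory Filter Topology Set
open scoped ContDiff

noncomputable section

namespace FvK

/-- The Euclidean plane. -/
abbrev Plane : Type := EuclideanSpace ℝ (Fin 2)

/-- The `j`-th vector of the canonical basis of the plane. -/
abbrev basisVec (j : Fin 2) : Plane := EuclideanSpace.single j 1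

/-! ### Geometry of the domain -/

/-- `Ω` has Lipschitz boundary: near each boundary point, in suitable orthonormal coordinates,
`Ω` is the strict epigraph of a Lipschitz function of one variable. -/
def HasLipschitzBoundary (Ω : Set Plane) : Prop :=
  ∀ x ∈ frontier Ω, ∃ r > 0, ∃ e : Plane ≃ₗᵢ[ℝ] Plane, ∃ L : NNReal, ∃ γ : ℝ → ℝ,
    LipschitzWith L γ ∧ ∀ y ∈ Metric.ball x r, (y ∈ Ω ↔ γ (e y 0) < e y 1)

/-- The arc-length measure on the boundary: the one-dimensional Hausdorff measure
restricted to `∂Ω`. -/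
def bdryMeasure (Ω : Set Plane) : Measure Plane :=
  (Measure.hausdorffMeasure 1 : Measure Plane).restrict (frontier Ω)

/-- `n` is the unit outer normal to `Ω` at `x`: around `x`, every cone strictly inside the
half-plane opposite to `n` lies in `Ω`, and every cone strictly inside the half-plane of `n`
lies outside `Ω`.  (On a Lipschitz domain this is satisfied by exactly one `n` at almost every
boundary point.) -/
def IsOuterNormal (Ω : Set Plane) (x n : Plane) : Prop :=
  ‖n‖ = 1 ∧ ∀ η > 0, ∃ r > 0, ∀ y ∈ Metric.ball x r,
    (inner ℝ (y - x) n < -η * ‖y - x‖ → y ∈ Ω) ∧ (η * ‖y - x‖ < inner ℝ (y - x) n → y ∉ Ω)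

open Classical in
/-- The unit outer normal field, set to zero on the null set of boundary points without normal. -/
def outerNormal (Ω : Set Plane) (x : Plane) : Plane :=
  if h : ∃ n, IsOuterNormal Ω x n then h.choose else 0

/-! ### Sobolev spaces -/

/-- `L²(Ω)`. -/
abbrev L2 (Ω : Set Plane) : Type := Lp ℝ 2 (volume.restrict Ω)

/-- `v` is the distributional partial derivative `∂u/∂x_j` in `Ω`. -/
def IsWeakPartial (Ω : Set Plane) (j : Fin 2) (u v : L2 Ω) : Prop :=
  ∀ φ : Plane → ℝ, ContDiff ℝ ∞ φ → HasCompactSupport φ → tsupport φ ⊆ Ω →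
    ∫ x in Ω, u x * fderiv ℝ φ x (basisVec j) = - ∫ x in Ω, v x * φ x

lemma integrable_mul_of_test {Ω : Set Plane} (u : L2 Ω) {ψ : Plane → ℝ} (hψ : Continuous ψ)
    (hc : HasCompactSupport ψ) : Integrable (fun x => u x * ψ x) (volume.restrict Ω) :=
  MemLp.integrable_mul (p := 2) (q := 2) (Lp.memLp u) (hψ.memLp_of_hasCompactSupport hc)

lemma test_deriv {φ : Plane → ℝ} (h : ContDiff ℝ ∞ φ) (hc : HasCompactSupport φ) (j : Fin 2) :
    Continuous (fun x => fderiv ℝ φ x (basisVec j)) ∧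
      HasCompactSupport (fun x => fderiv ℝ φ x (basisVec j)) :=
  ⟨(h.continuous_fderiv (by simp)).clm_apply continuous_const, hc.fderiv_apply ℝ _⟩

lemma integral_add_mul {Ω : Set Plane} (u v : L2 Ω) {ψ : Plane → ℝ} (hψ : Continuous ψ)
    (hc : HasCompactSupport ψ) :
    ∫ x in Ω, (u + v) x * ψ x = (∫ x in Ω, u x * ψ x) + ∫ x in Ω, v x * ψ x := by
  rw [← integral_add (integrable_mul_of_test u hψ hc) (integrable_mul_of_test v hψ hc)]
  refine integral_congr_ae ?_
  filter_upwards [Lp.coeFn_add u v] with x hx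
  rw [hx, Pi.add_apply, add_mul]

lemma integral_smul_mul {Ω : Set Plane} (c : ℝ) (u : L2 Ω) (ψ : Plane → ℝ) :
    ∫ x in Ω, (c • u) x * ψ x = c * ∫ x in Ω, u x * ψ x := by
  rw [← integral_const_mul]
  refine integral_congr_ae ?_
  filter_upwards [Lp.coeFn_smul c u] with x hx
  rw [hx, Pi.smul_apply, smul_eq_mul, mul_assoc]

lemma IsWeakPartial.zero (Ω : Set Plane) (j : Fin 2) : IsWeakPartial Ω j 0 0 := by
  intro φ _ _ _
  have h := integral_smul_mul (0 : ℝ) (0 : L2 Ω) (fun x => fderiv ℝ φ x (basisVec j))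
  have h' := integral_smul_mul (0 : ℝ) (0 : L2 Ω) φ
  rw [zero_smul, zero_mul] at h h'
  rw [h, h', neg_zero]

lemma IsWeakPartial.add {Ω : Set Plane} {j : Fin 2} {u v u' v' : L2 Ω}
    (h : IsWeakPartial Ω j u v) (h' : IsWeakPartial Ω j u' v') :
    IsWeakPartial Ω j (u + u') (v + v') := by
  intro φ hφ hc hs
  obtain ⟨hd, hdc⟩ := test_deriv hφ hc j
  rw [integral_add_mul u u' hd hdc, integral_add_mul v v' hφ.continuous hc, h φ hφ hc hs,
    h' φ hφ hc hs, neg_add]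

lemma IsWeakPartial.smul {Ω : Set Plane} {j : Fin 2} {u v : L2 Ω} (c : ℝ)
    (h : IsWeakPartial Ω j u v) : IsWeakPartial Ω j (c • u) (c • v) := by
  intro φ hφ hc hs
  rw [integral_smul_mul, integral_smul_mul, h φ hφ hc hs, mul_neg]

/-- `H¹(Ω)`, realized as the space of pairs `(u, Du)` in `L² × (L²)²`.  The norm is
`‖u‖² + ∑ⱼ ‖∂ⱼu‖²` under a square root. -/
def H1Sub (Ω : Set Plane) : Submodule ℝ (WithLp 2 (L2 Ω × PiLp 2 (fun _ : Fin 2 => L2 Ω))) where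
  carrier := {U | ∀ j, IsWeakPartial Ω j U.fst (U.snd j)}
  zero_mem' := fun j => IsWeakPartial.zero Ω j
  add_mem' := fun h h' j => (h j).add (h' j)
  smul_mem' := fun c _ h j => (h j).smul c

/-- The Hilbert space `H¹(Ω)`. -/
def H1 (Ω : Set Plane) : Type := H1Sub Ω

instance (Ω : Set Plane) : NormedAddCommGroup (H1 Ω) := inferInstanceAs (NormedAddCommGroup (H1Sub Ω))

instance (Ω : Set Plane) : InnerProductSpace ℝ (H1 Ω) :=
  inferInstanceAs (InnerProductSpace ℝ (H1Sub Ω))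

/-- The underlying function of an element of `H¹(Ω)`. -/
def H1.val {Ω : Set Plane} (u : H1 Ω) : L2 Ω := u.1.fst

/-- The partial derivative `∂u/∂x_j` of an element of `H¹(Ω)`. -/
def H1.partial {Ω : Set Plane} (u : H1 Ω) (j : Fin 2) : L2 Ω := u.1.snd j

/-- `H²(Ω)`, realized as the space of pairs `(w, Dw)` in `L² × (H¹)²`.  The norm is
`‖w‖² + ∑ⱼ ‖∂ⱼw‖² + ∑ⱼₖ ‖∂ₖ∂ⱼw‖²` under a square root. -/
def H2Sub (Ω : Set Plane) : Submodule ℝ (WithLp 2 (L2 Ω × PiLp 2 (fun _ : Fin 2 => H1 Ω))) where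
  carrier := {W | ∀ j, IsWeakPartial Ω j W.fst (W.snd j).val}
  zero_mem' := fun j => IsWeakPartial.zero Ω j
  add_mem' := fun h h' j => (h j).add (h' j)
  smul_mem' := fun c _ h j => (h j).smul c

/-- The Hilbert space `H²(Ω)`. -/
def H2 (Ω : Set Plane) : Type := H2Sub Ω

instance (Ω : Set Plane) : NormedAddCommGroup (H2 Ω) := inferInstanceAs (NormedAddCommGroup (H2Sub Ω))

instance (Ω : Set Plane) : InnerProductSpace ℝ (H2 Ω) :=
  inferInstanceAs (InnerProductSpace ℝ (H2Sub Ω))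

/-- The partial derivative `∂w/∂x_j` of `w ∈ H²(Ω)`, as an element of `H¹(Ω)`. -/
def H2.partial {Ω : Set Plane} (w : H2 Ω) (j : Fin 2) : H1 Ω := w.1.snd j

/-- An element of `H²(Ω)` regarded as an element of `H¹(Ω)`. -/
def H2.toH1 {Ω : Set Plane} (w : H2 Ω) : H1 Ω :=
  ⟨WithLp.toLp 2 (w.1.fst, WithLp.toLp 2 (fun j => (w.partial j).val)), fun j => w.2 j⟩

/-- `H¹(Ω, ℝ²)`: vector fields with components in `H¹(Ω)`. -/
abbrev H1Vec (Ω : Set Plane) : Type := PiLp 2 (fun _ : Fin 2 => H1 Ω)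

/-! ### Boundary values -/

/-- `T` is a trace operator: a bounded linear map `H¹(Ω) → L²(∂Ω)` that coincides with the
restriction to the boundary on functions that are smooth up to the boundary.  (On a bounded
Lipschitz domain there is exactly one.) -/
def IsTraceOperator (Ω : Set Plane) (T : H1 Ω →L[ℝ] Lp ℝ 2 (bdryMeasure Ω)) : Prop :=
  ∀ (φ : Plane → ℝ) (u : H1 Ω), ContDiff ℝ ∞ φ → u.val =ᵐ[volume.restrict Ω] φ →
    T u =ᵐ[bdryMeasure Ω] φ

open Classical in
/-- The trace operator of `Ω` (zero if `Ω` is so irregular that none exists). -/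
def trace (Ω : Set Plane) : H1 Ω →L[ℝ] Lp ℝ 2 (bdryMeasure Ω) :=
  if h : ∃ T, IsTraceOperator Ω T then h.choose else 0

/-- `w = 0` on `Γ`, in the sense of traces, almost everywhere for arc length. -/
def VanishesOn (Ω Γ : Set Plane) (w : H2 Ω) : Prop :=
  ∀ᵐ x ∂(bdryMeasure Ω), x ∈ Γ → trace Ω w.toH1 x = 0

/-- `∂w/∂n = 0` on `Γ`, in the sense of traces, almost everywhere for arc length. -/
def NormalDerivVanishesOn (Ω Γ : Set Plane) (w : H2 Ω) : Prop :=
  ∀ᵐ x ∂(bdryMeasure Ω), x ∈ Γ → ∑ j, trace Ω (w.partial j) x * outerNormal Ω x j = 0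

/-- `{w ∈ H²(Ω) : w = 0 on Γ}`. -/
def supportedSub (Ω Γ : Set Plane) : Submodule ℝ (H2 Ω) where
  carrier := {w | VanishesOn Ω Γ w}
  zero_mem' := by
    change ∀ᵐ x ∂(bdryMeasure Ω), x ∈ Γ → trace Ω (0 : H1 Ω) x = 0
    rw [map_zero]
    filter_upwards [Lp.coeFn_zero ℝ 2 (bdryMeasure Ω)] with x hx _
    simp only [hx, Pi.zero_apply]
  add_mem' := by
    intro a b ha hb
    change ∀ᵐ x ∂(bdryMeasure Ω), x ∈ Γ → trace Ω (a.toH1 + b.toH1) x = 0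
    rw [map_add]
    filter_upwards [ha, hb, Lp.coeFn_add (trace Ω a.toH1) (trace Ω b.toH1)] with x h1 h2 h3 hx
    rw [h3, Pi.add_apply, h1 hx, h2 hx, add_zero]
  smul_mem' := by
    intro c a ha
    change ∀ᵐ x ∂(bdryMeasure Ω), x ∈ Γ → trace Ω (c • a.toH1) x = 0
    rw [map_smul]
    filter_upwards [ha, Lp.coeFn_smul c (trace Ω a.toH1)] with x h1 h3 hx
    rw [h3, Pi.smul_apply, h1 hx, smul_zero]

/-- `{w ∈ H²(Ω) : ∂w/∂n = 0 on Γ}`. -/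
def normalDerivSub (Ω Γ : Set Plane) : Submodule ℝ (H2 Ω) where
  carrier := {w | NormalDerivVanishesOn Ω Γ w}
  zero_mem' := by
    change ∀ᵐ x ∂(bdryMeasure Ω), x ∈ Γ →
      ∑ j, trace Ω (0 : H1 Ω) x * outerNormal Ω x j = 0
    rw [map_zero]
    filter_upwards [Lp.coeFn_zero ℝ 2 (bdryMeasure Ω)] with x hx _
    simp only [hx, Pi.zero_apply, zero_mul, Finset.sum_const_zero]
  add_mem' := by
    intro a b ha hb
    change ∀ᵐ x ∂(bdryMeasure Ω), x ∈ Γ →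
      ∑ j, trace Ω (a.partial j + b.partial j) x * outerNormal Ω x j = 0
    have h := fun j => Lp.coeFn_add (trace Ω (a.partial j)) (trace Ω (b.partial j))
    filter_upwards [ha, hb, ae_all_iff.2 h] with x h1 h2 h3 hx
    simp only [map_add, h3, Pi.add_apply, add_mul, Finset.sum_add_distrib, h1 hx, h2 hx,
      add_zero]
  smul_mem' := by
    intro c a ha
    change ∀ᵐ x ∂(bdryMeasure Ω), x ∈ Γ →
      ∑ j, trace Ω (c • a.partial j) x * outerNormal Ω x j = 0
    have h := fun j => Lp.coeFn_smul c (trace Ω (a.partial j))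
    filter_upwards [ha, ae_all_iff.2 h] with x h1 h3 hx
    simp only [map_smul, h3, Pi.smul_apply, smul_eq_mul, mul_assoc, ← Finset.mul_sum, h1 hx,
      mul_zero]

/-- The spaces `𝒜⁰`, `𝒜¹`, `𝒜²` of admissible out-of-plane displacements: plates that are
clamped on `Γ`, simply supported on `Γ`, free. -/
def admissible (Ω Γ : Set Plane) : Fin 3 → Submodule ℝ (H2 Ω)
  | 0 => supportedSub Ω Γ ⊓ normalDerivSub Ω Γ
  | 1 => supportedSub Ω Γ
  | 2 => ⊤

/-! ### Tensors and the elastic energy density -/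

/-- Real `2 × 2` matrices. -/
abbrev Mat : Type := Matrix (Fin 2) (Fin 2) ℝ

/-- The scalar product `A : B`. -/
def ddot (A B : Mat) : ℝ := ∑ i, ∑ j, A i j * B i j

/-- The energy density `J` (`E` is the Young modulus, `ν` the Poisson ratio).  On symmetric
matrices it equals `E / (2 (1 - ν²)) * (|tr A|² - 2 (1 - ν) det A)`. -/
def J (E ν : ℝ) (A : Mat) : ℝ :=
  E / (2 * (1 + ν)) * ddot A A + E * ν / (2 * (1 - ν ^ 2)) * A.trace ^ 2

/-- The derivative of `J`. -/
def J' (E ν : ℝ) (A : Mat) : Mat :=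
  (E / (1 + ν)) • A + (E * ν / (1 - ν ^ 2) * A.trace) • (1 : Mat)

/-- The linearized strain tensor `𝔼(u) = (Du + Duᵀ) / 2`. -/
def strain {Ω : Set Plane} (u : H1Vec Ω) (x : Plane) : Mat :=
  Matrix.of fun i j => ((u i).partial j x + (u j).partial i x) / 2

/-- The tensor `Dw ⊗ Dw`. -/
def gradTensor {Ω : Set Plane} (w : H2 Ω) (x : Plane) : Mat :=
  Matrix.of fun i j => (w.partial i).val x * (w.partial j).val x

/-- The hessian `D²w`. -/
def hessian {Ω : Set Plane} (w : H2 Ω) (x : Plane) : Mat :=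
  Matrix.of fun i j => (w.partial i).partial j x

/-- The work `∫_{∂Ω} f · u` of the in-plane load. -/
def loadWork {Ω : Set Plane} (f : Lp Plane 2 (bdryMeasure Ω)) (u : H1Vec Ω) : ℝ :=
  ∫ x, ∑ j, f x j * trace Ω (u j) x ∂(bdryMeasure Ω)

/-- The in-plane load is equilibrated: it does no work on infinitesimal rigid displacements. -/
def Equilibrated {Ω : Set Plane} (f : Lp Plane 2 (bdryMeasure Ω)) : Prop :=
  ∀ z : H1Vec Ω, (∀ᵐ x ∂(volume.restrict Ω), strain z x = 0) → loadWork f z = 0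

/-! ### Föppl–von Kármán functionals (without out-of-plane load) -/

/-- The bending energy. -/
def bendingEnergy {Ω : Set Plane} (E ν h : ℝ) (w : H2 Ω) : ℝ :=
  h ^ 3 / 12 * ∫ x in Ω, J E ν (hessian w x)

/-- The membrane energy. -/
def membraneEnergy {Ω : Set Plane} (E ν h : ℝ) (u : H1Vec Ω) (w : H2 Ω) : ℝ :=
  h * ∫ x in Ω, J E ν (strain u x + (1 / 2 : ℝ) • gradTensor w x)

/-- The Föppl–von Kármán functional `ℱ_h`, with in-plane load `f`. -/
def fvkEnergy {Ω : Set Plane} (E ν h : ℝ) (f : Lp Plane 2 (bdryMeasure Ω))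
    (u : H1Vec Ω) (w : H2 Ω) : ℝ :=
  membraneEnergy E ν h u w + bendingEnergy E ν h w - h * loadWork f u

open Classical in
/-- The functional `ℱ_h^i`, which takes the value `+∞` where the boundary condition fails. -/
def fvkEnergyBC {Ω : Set Plane} (Γ : Set Plane) (i : Fin 3) (E ν h : ℝ)
    (f : Lp Plane 2 (bdryMeasure Ω)) (u : H1Vec Ω) (w : H2 Ω) : EReal :=
  if w ∈ admissible Ω Γ i then (fvkEnergy E ν h f u w : EReal) else ⊤

/-- The flat energy `ℱ_{h,0}(u) = ℱ_h(u, 0)`. -/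
def flatEnergy {Ω : Set Plane} (E ν h : ℝ) (f : Lp Plane 2 (bdryMeasure Ω))
    (u : H1Vec Ω) : ℝ :=
  fvkEnergy E ν h f u 0

/-- `u` minimizes the flat energy over `H¹(Ω, ℝ²)`. -/
def IsFlatMinimizer {Ω : Set Plane} (E ν h : ℝ) (f : Lp Plane 2 (bdryMeasure Ω))
    (u : H1Vec Ω) : Prop :=
  IsMinOn (flatEnergy E ν h f) univ u

/-- The rescaled functional `ℰ_{h,ε}^i(u, w) = ε⁻² (ℱ_h^i(u, ε w) - min ℱ_{h,0})`. -/
def rescaledEnergy {Ω : Set Plane} (Γ : Set Plane) (i : Fin 3) (E ν h : ℝ)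
    (f : Lp Plane 2 (bdryMeasure Ω)) (ε : ℝ) (u : H1Vec Ω) (w : H2 Ω) : EReal :=
  (((ε ^ 2)⁻¹ : ℝ) : EReal) *
    (fvkEnergyBC Γ i E ν h f u (ε • w) - ((⨅ v, flatEnergy E ν h f v : ℝ) : EReal))

open Classical in
/-- The limit energy `ℰ_h^i`. -/
def limitEnergy {Ω : Set Plane} (Γ : Set Plane) (i : Fin 3) (E ν h : ℝ)
    (f : Lp Plane 2 (bdryMeasure Ω)) (u : H1Vec Ω) (w : H2 Ω) : EReal :=
  if IsFlatMinimizer E ν h f u ∧ w ∈ admissible Ω Γ i then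
    ((bendingEnergy E ν h w +
      h / 2 * ∫ x in Ω, ddot (J' E ν (strain u x)) (gradTensor w x) : ℝ) : EReal)
  else ⊤

/-- The functional `𝒬_w`. -/
def Q {Ω : Set Plane} (E ν : ℝ) (w : H2 Ω) (z : H1Vec Ω) : ℝ :=
  ∫ x in Ω, J E ν (strain z x + (1 / 2 : ℝ) • gradTensor w x)

/-! ### Critical points and uniform Palais–Smale sequences -/

/-- `x` is a critical point of `I`: the differential of `I` at `x` exists and vanishes. -/
def IsCriticalPoint {X : Type*} [NormedAddCommGroup X] [NormedSpace ℝ X] (I : X → ℝ)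
    (x : X) : Prop :=
  HasFDerivAt I (0 : X →L[ℝ] ℝ) x

/-- `(x_ε)` is a uniform Palais–Smale sequence, as `ε → 0⁺`, for the `C¹` functionals `I_ε`. -/
structure IsUniformPalaisSmale {X : Type*} [NormedAddCommGroup X] [NormedSpace ℝ X]
    (I : ℝ → X → ℝ) (x : ℝ → X) : Prop where
  contDiff : ∀ ε > 0, ContDiff ℝ 1 (I ε)
  bounded : ∃ C > 0, ∀ ε ∈ Ioc (0 : ℝ) 1, I ε (x ε) ≤ C
  tendsto_norm : Tendsto (fun ε => ‖fderiv ℝ (I ε) (x ε)‖) (𝓝[>] 0) (𝓝 0)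

end FvK

end

open scoped ENNReal

noncomputable section

namespace FvK

/-! ### Functions with a weak directional derivative -/

/-! Write S for the linearized strain, G for the bilinear form with G(w,w) = Dw ⊗ Dw, b(A,B) = ∫
J'(A) : B, and set B = S z + G(w,w)/2. Along the family (u + ε²z, εw) the membrane strain is exactly
S u + ε²B, so the energy is an explicit polynomial in ε.

Values: after division by ε², the singular term is the flat minimum, which has been subtracted. At
order 0 the Euler equation of u cancels the work of the load on z against b(S u, S z), and what is
left is the limit energy. The remainder is ε² h b(B,B)/2 (`rescaledPlateEnergy_recovery`).

Differential in the direction (φ,ψ): the order ε⁻² vanishes by equilibrium of u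
(`flat_equilibrium`). The order 0 vanishes by the Euler equation of z for φ
(`corrector_equilibrium`) and by criticality of w for ψ. Only ε²(h/2) b(B, G(w,ψ) + G(ψ,w))
survives, so the norm is a fixed constant times ε² (`hasFDerivAt_rescaledPlateEnergy_recovery`).

All this requires S, G, b, the bending form and the load to be bounded (multi)linear maps; the
functionals are then polynomials, hence C¹. The delicate point is that Dw ⊗ Dw lies in L², that is,
the embedding of H¹ into L⁴ (`H1.exists_eLpNorm_four_le`). Near each point of the closure, short
segments in two independent directions stay in Ω. Along each direction |u|² is bounded by a line
integral of the squared first-order jet. The product of the two bounds controls |u|⁴, and its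
integral factorizes. -/

/-- On the zero extensions to the plane, `g` is the weak derivative of `f` in `Ω` along `d`. -/
def IsWeakDirDeriv (Ω : Set Plane) (d : Plane) (f g : Plane → ℝ) : Prop :=
  ∀ φ : Plane → ℝ, ContDiff ℝ ∞ φ → HasCompactSupport φ → tsupport φ ⊆ Ω →
    ∫ x, f x * fderiv ℝ φ x d = - ∫ x, g x * φ x

lemma exists_bound_of_test {ψ : Plane → ℝ} (hψ : Continuous ψ) (hc : HasCompactSupport ψ) :
    ∃ C, ∀ x, ‖ψ x‖ ≤ C := by
  obtain ⟨C, hC⟩ := hc.exists_bound_of_continuous hψ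
  exact ⟨C, hC⟩

lemma integrable_mul_of_bounded {f ψ : Plane → ℝ} (hf : Integrable f) (hψ : Continuous ψ)
    {C : ℝ} (hC : ∀ x, ‖ψ x‖ ≤ C) : Integrable fun x => f x * ψ x :=
  hf.mul_bdd hψ.aestronglyMeasurable (ae_of_all _ hC)

/-- Translating a test function differentiates the pairing in the weak sense. -/
lemma hasDerivAt_integral_translate {Ω U : Set Plane} {d : Plane} {f g : Plane → ℝ}
    (hf : Integrable f) (hfg : IsWeakDirDeriv Ω d f g) {φ : Plane → ℝ} (hφ : ContDiff ℝ ∞ φ)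
    (hc : HasCompactSupport φ) (hs : tsupport φ ⊆ U) {t : ℝ} (ht : ∀ y ∈ U, y + t • d ∈ Ω) :
    HasDerivAt (fun s : ℝ => ∫ y, f y * φ (y - s • d)) (∫ y, g y * φ (y - t • d)) t := by
  have hd : Continuous fun x => fderiv ℝ φ x d :=
    (hφ.continuous_fderiv (by simp)).clm_apply continuous_const
  obtain ⟨C, hC⟩ := exists_bound_of_test hd (hc.fderiv_apply ℝ d)
  obtain ⟨C', hC'⟩ := exists_bound_of_test hφ.continuous hc
  have hsub : ∀ s : ℝ, Continuous fun y : Plane => y - s • d := fun s => by fun_prop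
  have hint : ∀ s : ℝ, Integrable fun y => f y * φ (y - s • d) := fun s =>
    integrable_mul_of_bounded hf (hφ.continuous.comp (hsub s)) fun x => hC' _
  have key := hasDerivAt_integral_of_dominated_loc_of_deriv_le (μ := (volume : Measure Plane))
    (F := fun (s : ℝ) y => f y * φ (y - s • d))
    (F' := fun (s : ℝ) y => f y * (- fderiv ℝ φ (y - s • d) d))
    (bound := fun y => ‖f y‖ * C) (x₀ := t) (s := univ) univ_mem
    (Eventually.of_forall fun s => (hint s).aestronglyMeasurable) (hint t)
    (hf.aestronglyMeasurable.mul ((hd.comp (hsub t)).neg.aestronglyMeasurable))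
    (ae_of_all _ fun y s _ => by
      rw [norm_mul, norm_neg]
      exact mul_le_mul_of_nonneg_left (hC _) (norm_nonneg _))
    (hf.norm.mul_const C)
    (ae_of_all _ fun y s _ => by
      have h1 : HasFDerivAt φ (fderiv ℝ φ (y - s • d)) (y - s • d) :=
        (hφ.differentiable (by simp) _).hasFDerivAt
      have h2 : HasDerivAt (fun s : ℝ => y - s • d) (-d) s := by
        simpa using ((hasDerivAt_id s).smul_const d).const_sub y
      have := (h1.comp_hasDerivAt s h2).const_mul (f y)
      simpa using this)
  have hψ : ContDiff ℝ ∞ fun y => φ (y - t • d) := hφ.comp (contDiff_id.sub contDiff_const)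
  have hψs : tsupport (fun y => φ (y - t • d)) ⊆ Ω := by
    intro y hy
    have := ht _ (hs (tsupport_comp_subset_preimage φ (hsub t) hy))
    simpa using this
  have hψc : HasCompactSupport fun y => φ (y - t • d) := by
    have := hc.comp_homeomorph (Homeomorph.subRight (t • d))
    exact this
  -- The test function here is φ translated by t • d: its support lies in U + t • d, hence in Ω, so
  -- the weak derivative may be used.
  have hibp : ∫ y, f y * fderiv ℝ φ (y - t • d) d = -∫ y, g y * φ (y - t • d) := by
    rw [← hfg _ hψ hψc hψs]
    refine integral_congr_ae (ae_of_all _ fun y => ?_)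
    simp only [fderiv_comp_sub]
  have hval : ∫ y, f y * (- fderiv ℝ φ (y - t • d) d) = ∫ y, g y * φ (y - t • d) := by
    simp only [mul_neg, integral_neg, hibp, neg_neg]
  exact hval ▸ key.2

/-- Translations along a segment turn an integrable function into an integrable function of two
variables. -/
lemma integrable_translate {f : Plane → ℝ} (hf : Integrable f) (hm : Measurable f) (d : Plane)
    (ρ : ℝ) : Integrable (fun p : Plane × ℝ => f (p.1 + p.2 • d))
      (volume.prod (volume.restrict (Ioc 0 ρ))) := by
  have hmeas : Measurable fun p : Plane × ℝ => f (p.1 + p.2 • d) := hm.comp (by fun_prop)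
  rw [integrable_prod_iff' hmeas.aestronglyMeasurable]
  refine ⟨ae_of_all _ fun t => hf.comp_add_right (t • d), ?_⟩
  have : ∀ t : ℝ, ∫ y, ‖f (y + t • d)‖ = ∫ y, ‖f y‖ := fun t =>
    integral_add_right_eq_self (fun y => ‖f y‖) (t • d)
  simp only [this]
  exact integrable_const _

/-- Representation of a function by its averages and its weak derivative on segments. -/
lemma ae_eq_integral_segment {Ω U : Set Plane} (hU : IsOpen U) {d : Plane} {f g : Plane → ℝ}
    (hf : Integrable f) (hfm : Measurable f) (hg : Integrable g) (hgm : Measurable g)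
    (hfg : IsWeakDirDeriv Ω d f g) {ρ : ℝ} (hρ : 0 < ρ)
    (hseg : ∀ y ∈ U, ∀ t ∈ Icc 0 ρ, y + t • d ∈ Ω) :
    ∀ᵐ y, y ∈ U →
      f y = ∫ t in Ioc 0 ρ, (ρ⁻¹ * f (y + t • d) - (1 - t / ρ) * g (y + t • d)) := by
  set H : Plane × ℝ → ℝ := fun p =>
    ρ⁻¹ * f (p.1 + p.2 • d) - (1 - p.2 / ρ) * g (p.1 + p.2 • d) with hH
  have hwt : ∀ᵐ p : Plane × ℝ ∂volume.prod (volume.restrict (Ioc 0 ρ)), ‖1 - p.2 / ρ‖ ≤ 1 := by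
    have h0 : ∀ᵐ t : ℝ ∂(volume.restrict (Ioc 0 ρ)), ‖1 - t / ρ‖ ≤ 1 := by
      filter_upwards [ae_restrict_mem measurableSet_Ioc] with t ht
      have h1 : t / ρ ≤ 1 := (div_le_one hρ).2 ht.2
      have h2 : 0 ≤ t / ρ := div_nonneg ht.1.le hρ.le
      rw [Real.norm_eq_abs, abs_le]; constructor <;> linarith
    exact Measure.quasiMeasurePreserving_snd.ae h0
  have hHi : Integrable H (volume.prod (volume.restrict (Ioc 0 ρ))) :=
    ((integrable_translate hf hfm d ρ).const_mul _).sub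
      ((integrable_translate hg hgm d ρ).bdd_mul
        (by fun_prop) hwt)
  have hK : Integrable fun y => ∫ t in Ioc 0 ρ, H (y, t) := hHi.integral_prod_left
  have hloc : LocallyIntegrableOn (fun y => f y - ∫ t in Ioc 0 ρ, H (y, t)) U :=
    (hf.sub hK).locallyIntegrable.locallyIntegrableOn U
  -- A locally integrable function that annihilates every test function supported in U vanishes a.e.
  -- on U; it remains to compare both sides of the identity against such a φ.
  have hzero := hU.ae_eq_zero_of_integral_contDiff_smul_eq_zero hloc ?_
  · filter_upwards [hzero] with y hy hyU using sub_eq_zero.1 (hy hyU)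
  intro φ hφ hc hs
  obtain ⟨C', hC'⟩ := exists_bound_of_test hφ.continuous hc
  set a : ℝ → ℝ := fun s => ∫ y, f y * φ (y - s • d) with ha
  set c : ℝ → ℝ := fun s => ∫ y, g y * φ (y - s • d) with hcdef
  have hder : ∀ t ∈ Icc 0 ρ, HasDerivAt a (c t) t := fun t ht =>
    hasDerivAt_integral_translate hf hfg hφ hc hs fun y hy => hseg y hy t ht
  have hcont : ∀ k : Plane → ℝ, Integrable k → Continuous fun s : ℝ => ∫ y, k y * φ (y - s • d) := by
    intro k hk
    refine continuous_of_dominated (bound := fun y => ‖k y‖ * C') (fun s => ?_) (fun s => ?_)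
      (hk.norm.mul_const _) (ae_of_all _ fun y => ?_)
    · exact (integrable_mul_of_bounded hk (hφ.continuous.comp (by fun_prop))
        fun x => hC' _).aestronglyMeasurable
    · exact ae_of_all _ fun y => by
        rw [norm_mul]; exact mul_le_mul_of_nonneg_left (hC' _) (norm_nonneg _)
    · exact continuous_const.mul (hφ.continuous.comp (by fun_prop))
  -- The weight 1 - t/ρ equals 1 at 0 and 0 at ρ, so the only boundary term is the pairing of f with
  -- the untranslated φ.
  have hparts := intervalIntegral.integral_mul_deriv_eq_deriv_mul (a := 0) (b := ρ)
    (u := fun t => 1 - t / ρ) (u' := fun _ => -ρ⁻¹) (v := a) (v' := c)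
    (fun t _ => by
      simpa [div_eq_mul_inv] using ((hasDerivAt_id t).mul_const ρ⁻¹).const_sub 1)
    (fun t ht => hder t (by rwa [uIcc_of_le hρ.le] at ht))
    intervalIntegrable_const ((hcont g hg).intervalIntegrable _ _)
  have htr : ∀ (k : Plane → ℝ) (t : ℝ),
      ∫ y, φ y * k (y + t • d) = ∫ y, k y * φ (y - t • d) := by
    intro k t
    rw [← integral_add_right_eq_self (fun y => k y * φ (y - t • d)) (t • d)]
    simp [mul_comm]
  have hφH : Integrable (Function.uncurry fun (y : Plane) (t : ℝ) => φ y * H (y, t))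
      (volume.prod (volume.restrict (Ioc 0 ρ))) :=
    hHi.bdd_mul (f := fun p : Plane × ℝ => φ p.1)
      (hφ.continuous.comp continuous_fst).aestronglyMeasurable (ae_of_all _ fun p => hC' p.1)
  have hφi : ∀ k : Plane → ℝ, Integrable k → ∀ t : ℝ, Integrable fun y => φ y * k (y + t • d) :=
    fun k hk t => (hk.comp_add_right (t • d)).bdd_mul hφ.continuous.aestronglyMeasurable
      (ae_of_all _ hC')
  have hinner : ∀ t : ℝ, ∫ y, φ y * H (y, t) = ρ⁻¹ * a t - (1 - t / ρ) * c t := by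
    intro t
    have h1 : ∀ y, φ y * H (y, t) =
        ρ⁻¹ * (φ y * f (y + t • d)) - (1 - t / ρ) * (φ y * g (y + t • d)) := fun y => by
      simp only [hH]; ring
    simp only [h1]
    rw [integral_sub ((hφi f hf t).const_mul _) ((hφi g hg t).const_mul _),
      integral_const_mul, integral_const_mul, htr, htr]
  have hfub : ∫ y, φ y * ∫ t in Ioc 0 ρ, H (y, t) = a 0 := by
    simp only [← integral_const_mul]
    rw [integral_integral_swap hφH]
    simp only [hinner]
    rw [← intervalIntegral.integral_of_le hρ.le, intervalIntegral.integral_sub, hparts,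
      intervalIntegral.integral_const_mul, intervalIntegral.integral_const_mul]
    · simp [div_self hρ.ne']
    · exact ((hcont f hf).const_mul _).intervalIntegrable _ _
    · exact (Continuous.mul (by fun_prop) (hcont g hg)).intervalIntegrable _ _
  simp only [smul_eq_mul, mul_sub]
  rw [integral_sub, hfub]
  · simp [ha, mul_comm]
  · exact hf.bdd_mul hφ.continuous.aestronglyMeasurable (ae_of_all _ hC')
  · exact hK.bdd_mul hφ.continuous.aestronglyMeasurable (ae_of_all _ hC')

/-! ### Estimates on lines -/

/-- Cauchy–Schwarz against the constant 1. -/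
lemma sq_lintegral_le {α : Type*} [MeasurableSpace α] (μ : Measure α) {F : α → ℝ≥0∞}
    (hF : AEMeasurable F μ) : (∫⁻ x, F x ∂μ) ^ 2 ≤ μ univ * ∫⁻ x, F x ^ 2 ∂μ := by
  have h := ENNReal.lintegral_mul_le_Lp_mul_Lq μ Real.HolderConjugate.two_two
    (f := fun _ => 1) (g := F) aemeasurable_const hF
  have h2 : ∀ a : ℝ≥0∞, (a ^ (2⁻¹ : ℝ)) ^ 2 = a := fun a => by
    rw [← ENNReal.rpow_natCast, ← ENNReal.rpow_mul]; norm_num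
  calc (∫⁻ x, F x ∂μ) ^ 2 ≤ _ := pow_le_pow_left' (by simpa using h) 2
    _ = _ := by rw [mul_pow, h2, h2]

/-- Cauchy–Schwarz in the segment representation, where the weight 1 - t/ρ is at most 1. Enlarging
the segment to the whole line makes the bound constant along lines parallel to d, which is what lets
the product of two such bounds factorize. -/
lemma ae_sq_enorm_le_lintegral_line {Ω U : Set Plane} (hU : IsOpen U) {d : Plane}
    {f g : Plane → ℝ} (hf : Integrable f) (hfm : Measurable f) (hg : Integrable g)
    (hgm : Measurable g) (hfg : IsWeakDirDeriv Ω d f g) {ρ : ℝ} (hρ : 0 < ρ)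
    (hseg : ∀ y ∈ U, ∀ t ∈ Icc 0 ρ, y + t • d ∈ Ω) {N : Plane → ℝ≥0∞} (hN : Measurable N)
    {κ : ℝ≥0∞} (hκ : ∀ y, ‖ρ⁻¹ * f y‖ₑ + ‖g y‖ₑ ≤ κ * N y) :
    ∀ᵐ y, y ∈ U → ‖f y‖ₑ ^ 2 ≤ ENNReal.ofReal ρ * κ ^ 2 * ∫⁻ t : ℝ, N (y + t • d) ^ 2 := by
  filter_upwards [ae_eq_integral_segment hU hf hfm hg hgm hfg hρ hseg] with y hy hyU
  have hNm : Measurable fun t : ℝ => N (y + t • d) := hN.comp (by fun_prop)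
  have h1 : ‖f y‖ₑ ≤ ∫⁻ t in Ioc 0 ρ, κ * N (y + t • d) := by
    conv_lhs => rw [hy hyU]
    refine (enorm_integral_le_lintegral_enorm _).trans (setLIntegral_mono (hNm.const_mul _) ?_)
    intro t ht
    refine le_trans ?_ (hκ _)
    refine enorm_sub_le.trans (add_le_add le_rfl ?_)
    rw [enorm_mul]
    refine mul_le_of_le_one_left' ?_
    have h1 : t / ρ ≤ 1 := (div_le_one hρ).2 ht.2
    have h2 : 0 ≤ t / ρ := div_nonneg ht.1.le hρ.le
    rw [Real.enorm_eq_ofReal_abs, ENNReal.ofReal_le_one, abs_le]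
    constructor <;> linarith
  calc ‖f y‖ₑ ^ 2 ≤ (∫⁻ t in Ioc 0 ρ, κ * N (y + t • d)) ^ 2 := pow_le_pow_left' h1 2
    _ ≤ _ := sq_lintegral_le _ (hNm.const_mul _).aemeasurable
    _ = ENNReal.ofReal ρ * κ ^ 2 * ∫⁻ t in Ioc 0 ρ, N (y + t • d) ^ 2 := by
      simp only [mul_pow]
      rw [lintegral_const_mul _ (hNm.pow_const 2), mul_assoc]
      simp
    _ ≤ _ := by gcongr; exact Measure.restrict_le_self

/-- The integral of the product of line integrals in two independent directions is controlled by
the product of the integrals. -/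
lemma exists_lintegral_mul_le (A : (ℝ × ℝ) ≃L[ℝ] Plane) :
    ∃ c : ℝ≥0∞, c ≠ ⊤ ∧ ∀ F : Plane → ℝ≥0∞, Measurable F →
      ∫⁻ y, (∫⁻ t : ℝ, F (y + t • A (1, 0))) * (∫⁻ t : ℝ, F (y + t • A (0, 1)))
        ≤ c * (∫⁻ y, F y) ^ 2 := by
  -- The image of Lebesgue measure under A is a Haar measure, so the two are proportional; this
  -- replaces a computation of the determinant.
  set m : Measure Plane := Measure.map A volume
  have : m.IsAddHaarMeasure := A.isAddHaarMeasure_map volume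
  have h1 := Measure.isAddLeftInvariant_eq_smul (volume : Measure Plane) m
  have h2 := Measure.isAddLeftInvariant_eq_smul m (volume : Measure Plane)
  set c₁ := (volume : Measure Plane).addHaarScalarFactor m
  set c₂ := m.addHaarScalarFactor (volume : Measure Plane)
  refine ⟨c₁ * c₂ ^ 2, by finiteness, fun F hF => ?_⟩
  have hA : Measurable A := A.continuous.measurable
  have hFA : Measurable fun p : ℝ × ℝ => F (A p) := hF.comp hA
  have hfin : ∫⁻ p : ℝ × ℝ, F (A p) = c₂ * ∫⁻ y, F y := by
    rw [← lintegral_map hF hA]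
    change ∫⁻ y, F y ∂m = _
    rw [h2, lintegral_smul_measure]; rfl
  have hlin : ∀ s t σ τ : ℝ, A (s, t) + (σ • A (1, 0) + τ • A (0, 1)) = A (s + σ, t + τ) := by
    intro s t σ τ
    rw [← map_smul, ← map_smul, ← map_add, ← map_add]; simp
  -- In the coordinates of A, the line integral along A (1, 0) depends only on the second coordinate
  -- and the one along A (0, 1) only on the first. By Tonelli the integral of their product splits.
  have e1 : ∀ s t : ℝ, ∫⁻ σ : ℝ, F (A (s, t) + σ • A (1, 0)) = ∫⁻ σ : ℝ, F (A (σ, t)) := by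
    intro s t
    have : ∀ σ : ℝ, F (A (s, t) + σ • A (1, 0)) = F (A (s + σ, t)) := fun σ => by
      have := hlin s t σ 0
      rw [zero_smul, add_zero, add_zero] at this
      rw [this]
    simp only [this]
    exact lintegral_add_left_eq_self (fun σ => F (A (σ, t))) s
  have e2 : ∀ s t : ℝ, ∫⁻ τ : ℝ, F (A (s, t) + τ • A (0, 1)) = ∫⁻ τ : ℝ, F (A (s, τ)) := by
    intro s t
    have : ∀ τ : ℝ, F (A (s, t) + τ • A (0, 1)) = F (A (s, t + τ)) := fun τ => by
      have := hlin s t 0 τ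
      rw [zero_smul, zero_add, add_zero] at this
      rw [this]
    simp only [this]
    exact lintegral_add_left_eq_self (fun τ => F (A (s, τ))) t
  have hline : ∀ d : Plane, Measurable fun y : Plane => ∫⁻ t : ℝ, F (y + t • d) := fun d =>
    Measurable.lintegral_prod_right' (f := fun p : Plane × ℝ => F (p.1 + p.2 • d))
      (hF.comp (by fun_prop))
  have m1 : Measurable fun t : ℝ => ∫⁻ σ : ℝ, F (A (σ, t)) :=
    Measurable.lintegral_prod_left' (f := fun p : ℝ × ℝ => F (A p)) hFA
  have m2 : Measurable fun s : ℝ => ∫⁻ τ : ℝ, F (A (s, τ)) :=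
    Measurable.lintegral_prod_right' (f := fun p : ℝ × ℝ => F (A p)) hFA
  refine le_of_eq ?_
  calc ∫⁻ y, (∫⁻ t : ℝ, F (y + t • A (1, 0))) * (∫⁻ t : ℝ, F (y + t • A (0, 1)))
      = c₁ * ∫⁻ y, (∫⁻ t : ℝ, F (y + t • A (1, 0))) * (∫⁻ t : ℝ, F (y + t • A (0, 1))) ∂m := by
        conv_lhs => rw [h1, lintegral_smul_measure]
        rfl
    _ = c₁ * ∫⁻ p : ℝ × ℝ, (∫⁻ τ : ℝ, F (A (p.1, τ))) * (∫⁻ σ : ℝ, F (A (σ, p.2))) := by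
        rw [show m = Measure.map A volume from rfl, lintegral_map
          (f := fun y => (∫⁻ t : ℝ, F (y + t • A (1, 0))) * (∫⁻ t : ℝ, F (y + t • A (0, 1))))
          ((hline _).mul (hline _)) hA]
        congr 1
        refine lintegral_congr fun p => ?_
        rw [show A p = A (p.1, p.2) from rfl, e1, e2, mul_comm]
    _ = c₁ * ((∫⁻ s : ℝ, ∫⁻ τ : ℝ, F (A (s, τ))) * ∫⁻ t : ℝ, ∫⁻ σ : ℝ, F (A (σ, t))) := by
        rw [Measure.volume_eq_prod, lintegral_prod_mul m2.aemeasurable m1.aemeasurable]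
    _ = _ := by
        have p1 : ∫⁻ s : ℝ, ∫⁻ τ : ℝ, F (A (s, τ)) = ∫⁻ p : ℝ × ℝ, F (A p) := by
          rw [Measure.volume_eq_prod, lintegral_prod _ hFA.aemeasurable]
        have p2 : ∫⁻ t : ℝ, ∫⁻ σ : ℝ, F (A (σ, t)) = ∫⁻ p : ℝ × ℝ, F (A p) := by
          rw [Measure.volume_eq_prod, lintegral_prod_symm _ hFA.aemeasurable]
        rw [p1, p2, hfin]; ring

/-! ### Segments in Lipschitz domains -/

/-- Near each point of the closure of an open set with Lipschitz boundary there are two independent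
directions along which short segments stay in the set. -/
lemma exists_segments {Ω : Set Plane} (hopen : IsOpen Ω) (hlip : HasLipschitzBoundary Ω)
    {x : Plane} (hx : x ∈ closure Ω) :
    ∃ r > 0, ∃ ρ > (0 : ℝ), ∃ A : (ℝ × ℝ) ≃L[ℝ] Plane, ∀ y ∈ Metric.ball x r ∩ Ω,
      ∀ t ∈ Icc 0 ρ, y + t • A (1, 0) ∈ Ω ∧ y + t • A (0, 1) ∈ Ω := by
  have hdim : Module.finrank ℝ (ℝ × ℝ) = Module.finrank ℝ Plane := by simp
  have hnear : ∀ (A : (ℝ × ℝ) ≃L[ℝ] Plane) (r : ℝ), 0 < r → ∃ ρ > (0 : ℝ),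
      ∀ y ∈ Metric.ball x (r / 2), ∀ t ∈ Icc 0 ρ,
        y + t • A (1, 0) ∈ Metric.ball x r ∧ y + t • A (0, 1) ∈ Metric.ball x r := by
    intro A r hr
    set M := ‖A (1, 0)‖ + ‖A (0, 1)‖ + 1 with hM
    have hMpos : 0 < M := by positivity
    refine ⟨r / 2 / M, by positivity, fun y hy t ht => ?_⟩
    have hball : ∀ d : Plane, ‖d‖ ≤ M → y + t • d ∈ Metric.ball x r := by
      intro d hd
      have h1 : ‖t • d‖ ≤ r / 2 := by
        rw [norm_smul, Real.norm_eq_abs, abs_of_nonneg ht.1]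
        calc t * ‖d‖ ≤ r / 2 / M * M := mul_le_mul ht.2 hd (norm_nonneg _) (by positivity)
          _ = r / 2 := by field_simp
      rw [Metric.mem_ball, dist_eq_norm] at hy ⊢
      calc ‖y + t • d - x‖ = ‖(y - x) + t • d‖ := by congr 1; abel
        _ ≤ ‖y - x‖ + ‖t • d‖ := norm_add_le _ _
        _ < r := by linarith
    have n1 := norm_nonneg (A (1, 0))
    have n2 := norm_nonneg (A (0, 1))
    exact ⟨hball _ (by linarith), hball _ (by linarith)⟩
  by_cases hxΩ : x ∈ Ω
  · obtain ⟨r, hr, hball⟩ := Metric.isOpen_iff.1 hopen x hxΩ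
    let A := ContinuousLinearEquiv.ofFinrankEq hdim
    obtain ⟨ρ, hρ, h⟩ := hnear A r hr
    exact ⟨r / 2, by positivity, ρ, hρ, A, fun y hy t ht =>
      ⟨hball (h y hy.1 t ht).1, hball (h y hy.1 t ht).2⟩⟩
  · obtain ⟨r, hr, e, L, γ, hγ, hr'⟩ := hlip x ⟨hx, by rwa [hopen.interior_eq]⟩
    -- In the graph coordinates the two directions are (1, L + 1) and (-1, L + 1), both steeper than
    -- the Lipschitz graph.
    let B : (ℝ × ℝ) →ₗ[ℝ] Plane :=
      { toFun := fun p => e.symm !₂[p.1 - p.2, (L + 1) * (p.1 + p.2)]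
        map_add' := fun p q => by
          rw [← map_add]; congr 1; ext j; fin_cases j <;> simp <;> ring
        map_smul' := fun a p => by
          rw [RingHom.id_apply, ← map_smul]; congr 1; ext j; fin_cases j <;> simp <;> ring }
    have hB : ∀ p, e (B p) = !₂[p.1 - p.2, (L + 1) * (p.1 + p.2)] := fun p =>
      e.apply_symm_apply _
    have hinj : Function.Injective B := by
      rw [← LinearMap.ker_eq_bot, LinearMap.ker_eq_bot']
      intro p hp
      have h0 : (!₂[p.1 - p.2, (L + 1) * (p.1 + p.2)] : Plane) = 0 := by
        rw [← hB, hp, map_zero]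
      have a0 := congrArg (fun v : Plane => v 0) h0
      have a1 := congrArg (fun v : Plane => v 1) h0
      simp only [Matrix.cons_val_zero, Matrix.cons_val_one, PiLp.zero_apply,
        Matrix.cons_val_fin_one] at a0 a1
      have hL : (L : ℝ) + 1 ≠ 0 := by positivity
      have a2 : p.1 + p.2 = 0 := (mul_eq_zero.1 a1).resolve_left hL
      exact Prod.ext (by simp; linarith) (by simp; linarith)
    let A : (ℝ × ℝ) ≃L[ℝ] Plane :=
      (LinearMap.linearEquivOfInjective B hinj hdim).toContinuousLinearEquiv
    have hA : ∀ p, A p = B p := fun p => rfl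
    obtain ⟨ρ, hρ, h⟩ := hnear A r hr
    refine ⟨r / 2, by positivity, ρ, hρ, A, fun y hy t ht => ?_⟩
    have hyr : y ∈ Metric.ball x r := Metric.ball_subset_ball (by linarith) hy.1
    have hyΩ := (hr' y hyr).1 hy.2
    have hstep : ∀ (d : Plane), |e d 0| ≤ 1 → e d 1 = L + 1 → y + t • d ∈ Metric.ball x r →
        y + t • d ∈ Ω := by
      intro d hd0 hd1 hmem
      rw [hr' _ hmem, map_add, map_smul, PiLp.add_apply, PiLp.add_apply, PiLp.smul_apply,
        PiLp.smul_apply, hd1, smul_eq_mul, smul_eq_mul]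
      -- A step of length t along d raises the height by (L + 1)t and γ by at most Lt, so the point
      -- stays above the graph.
      have hl := hγ.dist_le_mul (e y 0 + t * e d 0) (e y 0)
      rw [Real.dist_eq, Real.dist_eq, add_sub_cancel_left, abs_mul, abs_of_nonneg ht.1] at hl
      have hl' : (L : ℝ) * (t * |e d 0|) ≤ L * t :=
        mul_le_mul_of_nonneg_left (mul_le_of_le_one_right ht.1 hd0) L.2
      have := le_abs_self (γ (e y 0 + t * e d 0) - γ (e y 0))
      nlinarith [ht.1]
    refine ⟨hstep _ ?_ ?_ (h y hy.1 t ht).1, hstep _ ?_ ?_ (h y hy.1 t ht).2⟩ <;>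
      rw [hA, hB] <;> simp

/-! ### The embedding of `H¹` into `L⁴` -/

/-- A partial derivative on `H¹(Ω)`, as a continuous linear map. -/
def H1.partialL (Ω : Set Plane) (j : Fin 2) : H1 Ω →L[ℝ] L2 Ω :=
  ((PiLp.proj 2 (fun _ : Fin 2 => L2 Ω) j : _ →L[ℝ] _).comp
    (WithLp.sndL 2 ℝ (L2 Ω) (PiLp 2 fun _ : Fin 2 => L2 Ω))).comp (H1Sub Ω).subtypeL

/-- A partial derivative on `H²(Ω)`, as a continuous linear map. -/
def H2.partialL (Ω : Set Plane) (j : Fin 2) : H2 Ω →L[ℝ] H1 Ω :=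
  ((PiLp.proj 2 (fun _ : Fin 2 => H1 Ω) j : _ →L[ℝ] _).comp
    (WithLp.sndL 2 ℝ (L2 Ω) (PiLp 2 fun _ : Fin 2 => H1 Ω))).comp (H2Sub Ω).subtypeL

lemma H2.partialL_apply {Ω : Set Plane} (w : H2 Ω) (j : Fin 2) :
    H2.partialL Ω j w = w.partial j := rfl

lemma H1.enorm_val_le {Ω : Set Plane} (u : H1 Ω) : ‖u.val‖ₑ ≤ ‖u‖ₑ :=
  WithLp.enorm_fst_le _ u.1

lemma H1.enorm_partial_le {Ω : Set Plane} (u : H1 Ω) (j : Fin 2) : ‖u.partial j‖ₑ ≤ ‖u‖ₑ :=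
  (PiLp.enorm_apply_le u.1.snd j).trans (WithLp.enorm_snd_le _ u.1)

/-- The size of the first-order jet, extended by zero. -/
def H1.jetSize {Ω : Set Plane} (u : H1 Ω) : Plane → ℝ :=
  Ω.indicator fun x => |u.val x| + |u.partial 0 x| + |u.partial 1 x|

lemma measurable_coeFn {Ω : Set Plane} (v : L2 Ω) : Measurable (v : Plane → ℝ) :=
  (Lp.stronglyMeasurable v).measurable

lemma H1.measurable_jetSize {Ω : Set Plane} (hΩ : MeasurableSet Ω) (u : H1 Ω) :
    Measurable u.jetSize :=
  Measurable.indicator (((measurable_coeFn _).abs.add (measurable_coeFn _).abs).add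
    (measurable_coeFn _).abs) hΩ

/-- Minkowski's inequality with three terms, each of norm at most that of u; 9 = 3². -/
lemma H1.lintegral_jetSize_le {Ω : Set Plane} (hΩ : MeasurableSet Ω) (u : H1 Ω) :
    ∫⁻ x, ‖u.jetSize x‖ₑ ^ 2 ≤ 9 * ‖u‖ₑ ^ 2 := by
  have h : eLpNorm u.jetSize 2 volume ≤ 3 * ‖u‖ₑ := by
    rw [H1.jetSize, eLpNorm_indicator_eq_eLpNorm_restrict hΩ]
    have ha : ∀ v : L2 Ω, eLpNorm (fun x => |v x|) 2 (volume.restrict Ω) = ‖v‖ₑ := fun v => by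
      rw [Lp.enorm_def]; simpa only [Real.norm_eq_abs] using eLpNorm_norm (p := 2) (μ := volume.restrict Ω) (v : Plane → ℝ)
    have hm : ∀ v : L2 Ω, AEStronglyMeasurable (fun x => |v x|) (volume.restrict Ω) := fun v =>
      (measurable_coeFn v).abs.aestronglyMeasurable
    calc _ ≤ (‖u.val‖ₑ + ‖u.partial 0‖ₑ) + ‖u.partial 1‖ₑ := by
          rw [← ha, ← ha, ← ha]
          have h01 := eLpNorm_add_le (hm u.val) (hm (u.partial 0)) (p := 2) (by norm_num)
          have h012 := eLpNorm_add_le ((hm u.val).add (hm (u.partial 0))) (hm (u.partial 1))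
            (p := 2) (by norm_num)
          exact h012.trans (add_le_add h01 le_rfl)
      _ ≤ (‖u‖ₑ + ‖u‖ₑ) + ‖u‖ₑ := by
          gcongr
          exacts [u.enorm_val_le, u.enorm_partial_le 0, u.enorm_partial_le 1]
      _ = 3 * ‖u‖ₑ := by ring
  have h2 := eLpNorm_nnreal_pow_eq_lintegral (f := u.jetSize) (μ := volume) (p := 2) two_ne_zero
  simp only [NNReal.coe_ofNat, ENNReal.rpow_ofNat, ENNReal.coe_ofNat] at h2
  rw [← h2]
  calc _ ≤ (3 * ‖u‖ₑ) ^ 2 := pow_le_pow_left' h 2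
    _ = _ := by rw [mul_pow]; norm_num

lemma integrable_indicator_coeFn {Ω : Set Plane} (hΩ : MeasurableSet Ω)
    (hbdd : Bornology.IsBounded Ω) (v : L2 Ω) : Integrable (Ω.indicator v) := by
  have : IsFiniteMeasure (volume.restrict Ω) := ⟨by simpa using hbdd.measure_lt_top⟩
  rw [integrable_indicator_iff hΩ]
  exact (Lp.memLp v).integrable (by norm_num)

/-- The derivative along d is a linear combination of the partial ones. The extensions by zero do no
harm because the integrals over the plane reduce to integrals over Ω. -/
lemma H1.isWeakDirDeriv {Ω : Set Plane} (hΩ : MeasurableSet Ω) (u : H1 Ω) (d : Plane) :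
    IsWeakDirDeriv Ω d (Ω.indicator u.val)
      (fun x => d 0 * Ω.indicator (u.partial 0) x + d 1 * Ω.indicator (u.partial 1) x) := by
  intro φ hφ hc hs
  have hind : ∀ (v : L2 Ω) (ψ : Plane → ℝ),
      ∫ x, Ω.indicator v x * ψ x = ∫ x in Ω, v x * ψ x := fun v ψ => by
    rw [← integral_indicator hΩ]
    exact integral_congr_ae (ae_of_all _ fun x => (indicator_mul_left Ω v ψ).symm)
  have hii : ∀ (v : L2 Ω) {ψ : Plane → ℝ}, Continuous ψ → HasCompactSupport ψ →
      Integrable fun x => Ω.indicator v x * ψ x := fun v ψ h1 h2 => by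
    have := (integrable_indicator_iff hΩ).2 (integrable_mul_of_test v h1 h2)
    refine this.congr (ae_of_all _ fun x => indicator_mul_left Ω v ψ)
  have hd : ∀ x, fderiv ℝ φ x d
      = d 0 * fderiv ℝ φ x (basisVec 0) + d 1 * fderiv ℝ φ x (basisVec 1) := by
    intro x
    have : d = d 0 • basisVec 0 + d 1 • basisVec 1 := by
      ext j; fin_cases j <;> simp
    conv_lhs => rw [this]
    simp
  have t0 := test_deriv hφ hc 0
  have t1 := test_deriv hφ hc 1
  have w0 := u.2 0 φ hφ hc hs
  have w1 := u.2 1 φ hφ hc hs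
  have e1 : ∀ x, Ω.indicator u.val x * fderiv ℝ φ x d =
      d 0 * (Ω.indicator u.val x * fderiv ℝ φ x (basisVec 0)) +
        d 1 * (Ω.indicator u.val x * fderiv ℝ φ x (basisVec 1)) := fun x => by rw [hd]; ring
  have e2 : ∀ x, (d 0 * Ω.indicator (u.partial 0) x + d 1 * Ω.indicator (u.partial 1) x) * φ x =
      d 0 * (Ω.indicator (u.partial 0) x * φ x) +
        d 1 * (Ω.indicator (u.partial 1) x * φ x) := fun x => by ring
  simp only [e1, e2]
  rw [integral_add ((hii _ t0.1 t0.2).const_mul _) ((hii _ t1.1 t1.2).const_mul _),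
    integral_add ((hii _ hφ.continuous hc).const_mul _) ((hii _ hφ.continuous hc).const_mul _)]
  simp only [integral_const_mul, hind]
  have w0' : ∫ x in Ω, u.val x * fderiv ℝ φ x (basisVec 0) = -∫ x in Ω, u.partial 0 x * φ x := w0
  have w1' : ∫ x in Ω, u.val x * fderiv ℝ φ x (basisVec 1) = -∫ x in Ω, u.partial 1 x * φ x := w1
  rw [w0', w1']; ring

/-- The line estimate with a constant independent of u: the factor ρ comes from Cauchy–Schwarz, the
square from bounding ρ⁻¹|u| + |d · Du| by the jet. -/
lemma H1.ae_sq_enorm_le {Ω U : Set Plane} (hopen : IsOpen Ω) (hbdd : Bornology.IsBounded Ω)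
    (hU : IsOpen U) (hUΩ : U ⊆ Ω) (d : Plane) {ρ : ℝ} (hρ : 0 < ρ)
    (hseg : ∀ y ∈ U, ∀ t ∈ Icc 0 ρ, y + t • d ∈ Ω) :
    ∃ C : ℝ≥0∞, C ≠ ⊤ ∧ ∀ u : H1 Ω, ∀ᵐ y, y ∈ U →
      ‖u.val y‖ₑ ^ 2 ≤ C * ∫⁻ t : ℝ, ‖u.jetSize (y + t • d)‖ₑ ^ 2 := by
  have hΩ := hopen.measurableSet
  refine ⟨ENNReal.ofReal ρ * ENNReal.ofReal (ρ⁻¹ + |d 0| + |d 1|) ^ 2, by finiteness,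
    fun u => ?_⟩
  have hi := fun v : L2 Ω => integrable_indicator_coeFn hΩ hbdd v
  have hm := fun v : L2 Ω => (measurable_coeFn v).indicator hΩ
  have hκ : ∀ y, ‖ρ⁻¹ * Ω.indicator u.val y‖ₑ
      + ‖d 0 * Ω.indicator (u.partial 0) y + d 1 * Ω.indicator (u.partial 1) y‖ₑ
      ≤ ENNReal.ofReal (ρ⁻¹ + |d 0| + |d 1|) * ‖u.jetSize y‖ₑ := by
    intro y
    simp only [Real.enorm_eq_ofReal_abs]
    rw [← ENNReal.ofReal_add (abs_nonneg _) (abs_nonneg _), ← ENNReal.ofReal_mul (by positivity)]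
    refine ENNReal.ofReal_le_ofReal ?_
    by_cases hy : y ∈ Ω
    · simp only [H1.jetSize, indicator_of_mem hy]
      set a := u.val y
      set b := u.partial 0 y
      set c := u.partial 1 y
      rw [abs_of_nonneg (by positivity : 0 ≤ |a| + |b| + |c|), abs_mul,
        abs_of_pos (inv_pos.2 hρ)]
      have h1 := abs_add_le (d 0 * b) (d 1 * c)
      rw [abs_mul, abs_mul] at h1
      have ha := abs_nonneg a
      have hb := abs_nonneg b
      have hc := abs_nonneg c
      have h0 := abs_nonneg (d 0)
      have h1' := abs_nonneg (d 1)
      have hr := (inv_pos.2 hρ).le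
      nlinarith [mul_nonneg hr hb, mul_nonneg hr hc, mul_nonneg h0 ha, mul_nonneg h0 hc,
        mul_nonneg h1' ha, mul_nonneg h1' hb]
    · simp [H1.jetSize, indicator_of_notMem hy]
  have key := ae_sq_enorm_le_lintegral_line hU (hi u.val) (hm _)
    (((hi (u.partial 0)).const_mul (d 0)).add ((hi (u.partial 1)).const_mul (d 1)))
    (((hm _).const_mul _).add ((hm _).const_mul _)) (u.isWeakDirDeriv hΩ d) hρ hseg
    (u.measurable_jetSize hΩ).enorm hκ
  filter_upwards [key] with y hy hyU
  have := hy hyU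
  rwa [indicator_of_mem (hUΩ hyU)] at this

/-- The Gagliardo–Ladyzhenskaya argument: |u|⁴ = |u|² · |u|², with each factor bounded by a line
integral in its own direction. -/
lemma H1.exists_lintegral_le_local {Ω : Set Plane} (hopen : IsOpen Ω)
    (hbdd : Bornology.IsBounded Ω) (hlip : HasLipschitzBoundary Ω) {x : Plane}
    (hx : x ∈ closure Ω) :
    ∃ r > 0, ∃ C : ℝ≥0∞, C ≠ ⊤ ∧ ∀ u : H1 Ω,
      ∫⁻ y in Metric.ball x r ∩ Ω, ‖u.val y‖ₑ ^ 4 ≤ C * ‖u‖ₑ ^ 4 := by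
  obtain ⟨r, hr, ρ, hρ, A, hA⟩ := exists_segments hopen hlip hx
  have hU : IsOpen (Metric.ball x r ∩ Ω) := Metric.isOpen_ball.inter hopen
  obtain ⟨C₁, hC₁, h₁⟩ := H1.ae_sq_enorm_le hopen hbdd hU inter_subset_right (A (1, 0)) hρ
    fun y hy t ht => (hA y hy t ht).1
  obtain ⟨C₂, hC₂, h₂⟩ := H1.ae_sq_enorm_le hopen hbdd hU inter_subset_right (A (0, 1)) hρ
    fun y hy t ht => (hA y hy t ht).2
  obtain ⟨c, hc, hF⟩ := exists_lintegral_mul_le A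
  refine ⟨r, hr, C₁ * C₂ * c * 9 ^ 2, by finiteness, fun u => ?_⟩
  set F : Plane → ℝ≥0∞ := fun y => ‖u.jetSize y‖ₑ ^ 2
  have hFm : Measurable F := (u.measurable_jetSize hopen.measurableSet).enorm.pow_const 2
  have hline : ∀ d : Plane, Measurable fun y : Plane => ∫⁻ t : ℝ, F (y + t • d) := fun d =>
    Measurable.lintegral_prod_right' (f := fun p : Plane × ℝ => F (p.1 + p.2 • d))
      (hFm.comp (by fun_prop))
  calc ∫⁻ y in Metric.ball x r ∩ Ω, ‖u.val y‖ₑ ^ 4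
      ≤ ∫⁻ y in Metric.ball x r ∩ Ω, (C₁ * C₂) *
          ((∫⁻ t : ℝ, F (y + t • A (1, 0))) * (∫⁻ t : ℝ, F (y + t • A (0, 1)))) := by
        refine setLIntegral_mono_ae (((hline _).mul (hline _)).const_mul _).aemeasurable ?_
        filter_upwards [h₁ u, h₂ u] with y hy₁ hy₂ hy
        calc ‖u.val y‖ₑ ^ 4 = ‖u.val y‖ₑ ^ 2 * ‖u.val y‖ₑ ^ 2 := by ring
          _ ≤ (C₁ * _) * (C₂ * _) := mul_le_mul' (hy₁ hy) (hy₂ hy)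
          _ = _ := by ring
    _ ≤ ∫⁻ y, (C₁ * C₂) *
          ((∫⁻ t : ℝ, F (y + t • A (1, 0))) * (∫⁻ t : ℝ, F (y + t • A (0, 1)))) :=
        setLIntegral_le_lintegral _ _
    _ ≤ (C₁ * C₂) * (c * (∫⁻ y, F y) ^ 2) := by
        rw [lintegral_const_mul (f := fun y =>
          (∫⁻ t : ℝ, F (y + t • A (1, 0))) * (∫⁻ t : ℝ, F (y + t • A (0, 1)))) _
          ((hline _).mul (hline _))]
        exact mul_le_mul_right (hF F hFm) _
    _ ≤ (C₁ * C₂) * (c * (9 * ‖u‖ₑ ^ 2) ^ 2) := by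
        gcongr
        exact u.lintegral_jetSize_le hopen.measurableSet
    _ = _ := by ring

/-- On a bounded Lipschitz domain of the plane, `H¹` embeds continuously into `L⁴`. -/
theorem H1.exists_eLpNorm_four_le {Ω : Set Plane} (hopen : IsOpen Ω)
    (hbdd : Bornology.IsBounded Ω) (hlip : HasLipschitzBoundary Ω) :
    ∃ C : ℝ≥0∞, C ≠ ⊤ ∧ ∀ u : H1 Ω, eLpNorm u.val 4 (volume.restrict Ω) ≤ C * ‖u‖ₑ := by
  have hcomp : IsCompact (closure Ω) := hbdd.isCompact_closure
  have key : ∃ C : ℝ≥0∞, C ≠ ⊤ ∧ ∀ u : H1 Ω,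
      ∫⁻ y in closure Ω ∩ Ω, ‖u.val y‖ₑ ^ 4 ≤ C * ‖u‖ₑ ^ 4 := by
    -- The property passes to subsets and finite unions, so by compactness the local estimates
    -- suffice.
    refine hcomp.induction_on (p := fun s => ∃ C : ℝ≥0∞, C ≠ ⊤ ∧ ∀ u : H1 Ω,
      ∫⁻ y in s ∩ Ω, ‖u.val y‖ₑ ^ 4 ≤ C * ‖u‖ₑ ^ 4) ?_ ?_ ?_ ?_
    · exact ⟨0, by simp, fun u => by simp⟩
    · rintro s t hst ⟨C, hC, h⟩
      exact ⟨C, hC, fun u => (lintegral_mono_set (inter_subset_inter_left _ hst)).trans (h u)⟩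
    · rintro s t ⟨C, hC, h⟩ ⟨C', hC', h'⟩
      refine ⟨C + C', by finiteness, fun u => ?_⟩
      rw [union_inter_distrib_right, add_mul]
      exact (lintegral_union_le _ _ _).trans (add_le_add (h u) (h' u))
    · intro x hx
      obtain ⟨r, hr, C, hC, h⟩ := H1.exists_lintegral_le_local hopen hbdd hlip hx
      exact ⟨Metric.ball x r, mem_nhdsWithin_of_mem_nhds (Metric.ball_mem_nhds x hr), C, hC, h⟩
  obtain ⟨C, hC, h⟩ := key
  rw [inter_eq_right.2 subset_closure] at h
  refine ⟨C ^ (1 / 4 : ℝ), by finiteness, fun u => ?_⟩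
  rw [eLpNorm_eq_lintegral_rpow_enorm_toReal (by norm_num) (by norm_num)]
  have h4 : (‖u‖ₑ ^ 4) ^ (1 / 4 : ℝ) = ‖u‖ₑ := by
    rw [← ENNReal.rpow_natCast, ← ENNReal.rpow_mul]; norm_num
  calc (∫⁻ x in Ω, ‖u.val x‖ₑ ^ (4 : ℝ≥0∞).toReal) ^ (1 / (4 : ℝ≥0∞).toReal)
      = (∫⁻ x in Ω, ‖u.val x‖ₑ ^ 4) ^ (1 / 4 : ℝ) := by
        simp only [ENNReal.toReal_ofNat, ENNReal.rpow_ofNat]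
    _ ≤ (C * ‖u‖ₑ ^ 4) ^ (1 / 4 : ℝ) := ENNReal.rpow_le_rpow (h u) (by norm_num)
    _ = C ^ (1 / 4 : ℝ) * ‖u‖ₑ := by rw [ENNReal.mul_rpow_of_nonneg _ _ (by norm_num), h4]

/-! ### The energies as bounded multilinear forms -/

instance fact_one_le_four : Fact ((1 : ℝ≥0∞) ≤ 4) := ⟨by norm_num⟩

lemma H1.exists_toL4 {Ω : Set Plane} (hopen : IsOpen Ω) (hbdd : Bornology.IsBounded Ω)
    (hlip : HasLipschitzBoundary Ω) :
    ∃ ι : H1 Ω →L[ℝ] Lp ℝ 4 (volume.restrict Ω), ∀ u : H1 Ω,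
      ι u =ᵐ[volume.restrict Ω] u.val := by
  obtain ⟨C, hC, h⟩ := H1.exists_eLpNorm_four_le hopen hbdd hlip
  have hmem : ∀ u : H1 Ω, MemLp u.val 4 (volume.restrict Ω) := fun u =>
    ⟨Lp.aestronglyMeasurable _, (h u).trans_lt (by finiteness)⟩
  let ι : H1 Ω →ₗ[ℝ] Lp ℝ 4 (volume.restrict Ω) :=
    { toFun := fun u => (hmem u).toLp _
      map_add' := fun u v => by
        rw [← MemLp.toLp_add]
        exact MemLp.toLp_congr _ _ (Lp.coeFn_add u.val v.val)
      map_smul' := fun c u => by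
        rw [RingHom.id_apply, ← MemLp.toLp_const_smul]
        exact MemLp.toLp_congr _ _ (Lp.coeFn_smul c u.val) }
  refine ⟨ι.mkContinuous C.toReal fun u => ?_, fun u => (hmem u).coeFn_toLp⟩
  change ‖(hmem u).toLp _‖ ≤ _
  rw [Lp.norm_toLp, ← toReal_enorm u, ← ENNReal.toReal_mul]
  exact ENNReal.toReal_mono (by finiteness) (h u)

/-- Hölder with 1/4 + 1/4 = 1/2, after the embedding into L⁴. -/
lemma H1.exists_mulL {Ω : Set Plane} (hopen : IsOpen Ω) (hbdd : Bornology.IsBounded Ω)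
    (hlip : HasLipschitzBoundary Ω) :
    ∃ m : H1 Ω →L[ℝ] H1 Ω →L[ℝ] L2 Ω, ∀ a b : H1 Ω,
      m a b =ᵐ[volume.restrict Ω] fun x => a.val x * b.val x := by
  obtain ⟨ι, hι⟩ := H1.exists_toL4 hopen hbdd hlip
  have : ENNReal.HolderTriple 4 4 2 := ⟨by
    rw [← two_mul, show (4 : ℝ≥0∞) = 2 * 2 by norm_num,
      ENNReal.mul_inv (by norm_num) (by norm_num), ← mul_assoc,
      ENNReal.mul_inv_cancel (by norm_num) (by norm_num), one_mul]⟩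
  refine ⟨((ContinuousLinearMap.mul ℝ ℝ).holderL (volume.restrict Ω) 4 4 2).bilinearComp ι ι,
    fun a b => ?_⟩
  have h := (ContinuousLinearMap.mul ℝ ℝ).coeFn_holder (r := 2) (ι a) (ι b)
  filter_upwards [h, hι a, hι b] with x hx ha hb
  rw [← ha, ← hb]
  exact hx

/-- Square-integrable `2 × 2` tensor fields. -/
abbrev TensorField (Ω : Set Plane) : Type := Fin 2 → Fin 2 → L2 Ω

/-- `a` represents the tensor field `A` pointwise. -/
def TensorField.Represents {Ω : Set Plane} (A : TensorField Ω) (a : Plane → Mat) : Prop :=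
  ∀ i j, A i j =ᵐ[volume.restrict Ω] fun x => a x i j

/-- The entries of a tensor field. -/
def TensorField.entryL (Ω : Set Plane) (i j : Fin 2) : TensorField Ω →L[ℝ] L2 Ω :=
  (ContinuousLinearMap.proj (R := ℝ) (φ := fun _ : Fin 2 => L2 Ω) j).comp
    (ContinuousLinearMap.proj (R := ℝ) (φ := fun _ : Fin 2 => Fin 2 → L2 Ω) i)

/-- The trace of a tensor field. -/
def TensorField.traceL (Ω : Set Plane) : TensorField Ω →L[ℝ] L2 Ω :=
  ∑ i, TensorField.entryL Ω i i

/-- The bilinear form `∫ J'(A) : B`. -/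
def elasticForm (Ω : Set Plane) (E ν : ℝ) : TensorField Ω →L[ℝ] TensorField Ω →L[ℝ] ℝ :=
  (E / (1 + ν)) • ∑ i, ∑ j, (innerSL ℝ).bilinearComp (TensorField.entryL Ω i j)
      (TensorField.entryL Ω i j) +
    (E * ν / (1 - ν ^ 2)) • (innerSL ℝ).bilinearComp (TensorField.traceL Ω)
      (TensorField.traceL Ω)

lemma elasticForm_apply {Ω : Set Plane} (E ν : ℝ) (A B : TensorField Ω) :
    elasticForm Ω E ν A B = E / (1 + ν) * ∑ i, ∑ j, inner ℝ (A i j) (B i j) +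
      E * ν / (1 - ν ^ 2) * inner ℝ (∑ i, A i i) (∑ i, B i i) := by
  simp only [elasticForm, add_apply, smul_apply,
    sum_apply, ContinuousLinearMap.bilinearComp_apply, innerSL_apply_apply,
    TensorField.entryL, TensorField.traceL, ContinuousLinearMap.comp_apply,
    ContinuousLinearMap.proj_apply, smul_eq_mul]

lemma elasticForm_symm {Ω : Set Plane} (E ν : ℝ) (A B : TensorField Ω) :
    elasticForm Ω E ν A B = elasticForm Ω E ν B A := by
  simp only [elasticForm_apply, real_inner_comm]

lemma integral_ddot_J' {Ω : Set Plane} (E ν : ℝ) {A B : TensorField Ω} {a b : Plane → Mat}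
    (ha : A.Represents a) (hb : B.Represents b) :
    ∫ x in Ω, ddot (J' E ν (a x)) (b x) = elasticForm Ω E ν A B := by
  have hint : ∀ v w : L2 Ω, Integrable (fun x => inner ℝ (v x) (w x)) (volume.restrict Ω) :=
    fun v w => L2.integrable_inner v w
  rw [elasticForm_apply]
  simp only [L2.inner_def, Fin.sum_univ_two]
  have hadd : ∀ {p q : Plane → ℝ}, Integrable p (volume.restrict Ω) →
      Integrable q (volume.restrict Ω) → Integrable (fun x => p x + q x) (volume.restrict Ω) :=
    fun hp hq => hp.add hq
  rw [← integral_add (hint _ _) (hint _ _), ← integral_add (hint _ _) (hint _ _),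
    ← integral_add (hadd (hint _ _) (hint _ _)) (hadd (hint _ _) (hint _ _)),
    ← integral_const_mul, ← integral_const_mul, ← integral_add
      ((hadd (hadd (hint _ _) (hint _ _)) (hadd (hint _ _) (hint _ _))).const_mul _)
      ((hint _ _).const_mul _)]
  refine integral_congr_ae ?_
  filter_upwards [ha 0 0, ha 0 1, ha 1 0, ha 1 1, hb 0 0, hb 0 1, hb 1 0, hb 1 1,
    Lp.coeFn_add (A 0 0) (A 1 1), Lp.coeFn_add (B 0 0) (B 1 1)] with x a00 a01 a10 a11 b00 b01 b10
    b11 hA hB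
  rw [hA, hB]
  simp only [Pi.add_apply, a00, a01, a10, a11, b00, b01, b10, b11, ddot, J', Fin.sum_univ_two,
    Matrix.add_apply, Matrix.smul_apply, smul_eq_mul, Matrix.trace_fin_two, Matrix.one_apply_eq,
    RCLike.inner_apply, conj_trivial,
    Matrix.one_apply_ne (show (0 : Fin 2) ≠ 1 by decide),
    Matrix.one_apply_ne (show (1 : Fin 2) ≠ 0 by decide)]
  ring

/-- Euler's identity for a quadratic form. It holds for every ν, since division by zero gives 0 on
both sides. -/
lemma J_eq_ddot_J' (E ν : ℝ) (A : Mat) : J E ν A = 1 / 2 * ddot (J' E ν A) A := by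
  simp only [J, J', ddot, Fin.sum_univ_two, Matrix.add_apply, Matrix.smul_apply, smul_eq_mul,
    Matrix.trace_fin_two, Matrix.one_apply_eq,
    Matrix.one_apply_ne (show (0 : Fin 2) ≠ 1 by decide),
    Matrix.one_apply_ne (show (1 : Fin 2) ≠ 0 by decide)]
  have h1 : E / (2 * (1 + ν)) = 1 / 2 * (E / (1 + ν)) := by
    rw [← div_div, div_right_comm]; ring
  have h2 : E * ν / (2 * (1 - ν ^ 2)) = 1 / 2 * (E * ν / (1 - ν ^ 2)) := by
    rw [← div_div, div_right_comm]; ring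
  rw [h1, h2]; ring

lemma integral_J {Ω : Set Plane} (E ν : ℝ) {A : TensorField Ω} {a : Plane → Mat}
    (ha : A.Represents a) : ∫ x in Ω, J E ν (a x) = 1 / 2 * elasticForm Ω E ν A A := by
  simp only [J_eq_ddot_J', integral_const_mul, integral_ddot_J' E ν ha ha]

/-- The linearized strain, as a continuous linear map. -/
def strainL (Ω : Set Plane) : H1Vec Ω →L[ℝ] TensorField Ω :=
  ContinuousLinearMap.pi fun i => ContinuousLinearMap.pi fun j =>
    (2⁻¹ : ℝ) • ((H1.partialL Ω j).comp (PiLp.proj 2 (fun _ : Fin 2 => H1 Ω) i : _ →L[ℝ] _) +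
      (H1.partialL Ω i).comp (PiLp.proj 2 (fun _ : Fin 2 => H1 Ω) j : _ →L[ℝ] _))

/-- The hessian, as a continuous linear map. -/
def hessianL (Ω : Set Plane) : H2 Ω →L[ℝ] TensorField Ω :=
  ContinuousLinearMap.pi fun i => ContinuousLinearMap.pi fun j =>
    (H1.partialL Ω j).comp (H2.partialL Ω i)

lemma strainL_represents {Ω : Set Plane} (u : H1Vec Ω) :
    (strainL Ω u).Represents (strain u) := by
  intro i j
  change ⇑((2⁻¹ : ℝ) • ((u i).partial j + (u j).partial i)) =ᵐ[_] _
  filter_upwards [Lp.coeFn_smul (2⁻¹ : ℝ) ((u i).partial j + (u j).partial i),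
    Lp.coeFn_add ((u i).partial j) ((u j).partial i)] with x h1 h2
  rw [h1, Pi.smul_apply, h2, Pi.add_apply, smul_eq_mul, strain, Matrix.of_apply]
  ring

lemma hessianL_represents {Ω : Set Plane} (w : H2 Ω) :
    (hessianL Ω w).Represents (hessian w) := fun _ _ => EventuallyEq.rfl

/-- The entries of G(w, v) are ∂ᵢw ∂ⱼv. Thus G is not symmetric, and derivatives of its diagonal
involve both G w and `G.flip w`. -/
lemma exists_gradTensorL {Ω : Set Plane} (hopen : IsOpen Ω) (hbdd : Bornology.IsBounded Ω)
    (hlip : HasLipschitzBoundary Ω) :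
    ∃ G : H2 Ω →L[ℝ] H2 Ω →L[ℝ] TensorField Ω, ∀ w : H2 Ω,
      (G w w).Represents (gradTensor w) := by
  obtain ⟨m, hm⟩ := H1.exists_mulL hopen hbdd hlip
  let s : Fin 2 → Fin 2 → L2 Ω →L[ℝ] TensorField Ω := fun i j =>
    (ContinuousLinearMap.single ℝ (fun _ : Fin 2 => Fin 2 → L2 Ω) i).comp
      (ContinuousLinearMap.single ℝ (fun _ : Fin 2 => L2 Ω) j)
  refine ⟨∑ i, ∑ j, (ContinuousLinearMap.compL ℝ (H2 Ω) (L2 Ω) (TensorField Ω) (s i j)).comp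
    (m.bilinearComp (H2.partialL Ω i) (H2.partialL Ω j)), fun w i j => ?_⟩
  have : (∑ i, ∑ j, (ContinuousLinearMap.compL ℝ (H2 Ω) (L2 Ω) (TensorField Ω) (s i j)).comp
      (m.bilinearComp (H2.partialL Ω i) (H2.partialL Ω j))) w w i j =
      m (w.partial i) (w.partial j) := by
    simp only [sum_apply, ContinuousLinearMap.comp_apply,
      ContinuousLinearMap.compL_apply, ContinuousLinearMap.bilinearComp_apply,
      H2.partialL_apply, s, ContinuousLinearMap.single_apply, Finset.sum_apply]
    fin_cases i <;> fin_cases j <;> simp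
  rw [this]
  exact hm _ _

/-- The trace is bounded into L²(∂Ω), where it is paired with the components of f. -/
lemma exists_loadWorkL {Ω : Set Plane} (f : Lp Plane 2 (bdryMeasure Ω)) :
    ∃ L : H1Vec Ω →L[ℝ] ℝ, ∀ u, L u = loadWork f u := by
  let c : Fin 2 → Lp ℝ 2 (bdryMeasure Ω) := fun j =>
    (EuclideanSpace.proj j : Plane →L[ℝ] ℝ).compLp f
  refine ⟨∑ j, (innerSL ℝ (c j)).comp ((trace Ω).comp
    (PiLp.proj 2 (fun _ : Fin 2 => H1 Ω) j : _ →L[ℝ] _)), fun u => ?_⟩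
  have hc : ∀ j, c j =ᵐ[bdryMeasure Ω] fun x => f x j := fun j =>
    (EuclideanSpace.proj j : Plane →L[ℝ] ℝ).coeFn_compLp f
  have hi : ∀ j, (fun x => inner ℝ (c j x) (trace Ω (u j) x)) =ᵐ[bdryMeasure Ω]
      fun x => f x j * trace Ω (u j) x := fun j => by
    filter_upwards [hc j] with x hx
    rw [hx, real_inner_eq_re_inner, RCLike.inner_apply, conj_trivial, RCLike.re_to_real, mul_comm]
  rw [loadWork, integral_finsetSum _ fun j _ =>
    (L2.integrable_inner (𝕜 := ℝ) (c j) (trace Ω (u j))).congr (hi j)]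
  simp only [sum_apply, ContinuousLinearMap.comp_apply, innerSL_apply_apply]
  refine Finset.sum_congr rfl fun j _ => ?_
  rw [L2.inner_def]
  exact integral_congr_ae (hi j)

/-! ### Energies of Föppl–von Kármán type on normed spaces -/

/-- A polynomial `c₀ + c₁ t + c₂ t²` that is minimal at `t = 0` has no linear term. -/
lemma eq_zero_of_quadratic_min {c₁ c₂ : ℝ} (h : ∀ t : ℝ, 0 ≤ c₁ * t + c₂ * t ^ 2) : c₁ = 0 := by
  have hmin : IsLocalMin (fun t : ℝ => c₁ * t + c₂ * t ^ 2) 0 :=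
    Eventually.of_forall fun t => by simpa using h t
  have hd : HasDerivAt (fun t : ℝ => c₁ * t + c₂ * t ^ 2) c₁ 0 := by
    simpa using ((hasDerivAt_id (0 : ℝ)).const_mul c₁).fun_add
      (((hasDerivAt_id (0 : ℝ)).pow 2).const_mul c₂)
  exact hmin.hasDerivAt_eq_zero hd

section Abstract

variable {U W T : Type*} [NormedAddCommGroup U] [NormedSpace ℝ U] [NormedAddCommGroup W]
  [NormedSpace ℝ W] [NormedAddCommGroup T] [NormedSpace ℝ T]

/-- An energy with membrane strain `S u + G(w, w) / 2`, elastic form `b`, bending form `K` and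
in-plane load `L`. -/
def plateEnergy (S : U →L[ℝ] T) (G : W →L[ℝ] W →L[ℝ] T) (b : T →L[ℝ] T →L[ℝ] ℝ)
    (K : W →L[ℝ] W →L[ℝ] ℝ) (L : U →L[ℝ] ℝ) (h : ℝ) (u : U) (w : W) : ℝ :=
  h * (1 / 2 * b (S u + (1 / 2 : ℝ) • G w w) (S u + (1 / 2 : ℝ) • G w w)) +
    1 / 2 * K w w - h * L u

/-- The difference quotient of the plate energy under small out-of-plane displacements. -/
def rescaledPlateEnergy (S : U →L[ℝ] T) (G : W →L[ℝ] W →L[ℝ] T) (b : T →L[ℝ] T →L[ℝ] ℝ)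
    (K : W →L[ℝ] W →L[ℝ] ℝ) (L : U →L[ℝ] ℝ) (h : ℝ) (u : U) (ε : ℝ) (p : U × W) : ℝ :=
  (ε ^ 2)⁻¹ * (plateEnergy S G b K L h p.1 (ε • p.2) - plateEnergy S G b K L h u 0)

variable {S : U →L[ℝ] T} {G : W →L[ℝ] W →L[ℝ] T} {b : T →L[ℝ] T →L[ℝ] ℝ}
  {K : W →L[ℝ] W →L[ℝ] ℝ} {L : U →L[ℝ] ℝ} {h : ℝ}

lemma contDiff_rescaledPlateEnergy (u : U) (ε : ℝ) :
    ContDiff ℝ 1 (rescaledPlateEnergy S G b K L h u ε) := by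
  have hw : ContDiff ℝ 1 fun p : U × W => ε • p.2 := contDiff_snd.const_smul ε
  have hS : ContDiff ℝ 1 fun p : U × W => S p.1 := S.contDiff.comp contDiff_fst
  have hG : ContDiff ℝ 1 fun p : U × W => G (ε • p.2) (ε • p.2) :=
    (G.contDiff.comp hw).clm_apply hw
  have hK : ContDiff ℝ 1 fun p : U × W => K (ε • p.2) (ε • p.2) :=
    (K.contDiff.comp hw).clm_apply hw
  have hA : ContDiff ℝ 1 fun p : U × W => S p.1 + (1 / 2 : ℝ) • G (ε • p.2) (ε • p.2) :=
    hS.add (hG.const_smul _)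
  have hb : ContDiff ℝ 1 fun p : U × W => b (S p.1 + (1 / 2 : ℝ) • G (ε • p.2) (ε • p.2))
      (S p.1 + (1 / 2 : ℝ) • G (ε • p.2) (ε • p.2)) :=
    (b.contDiff.comp hA).clm_apply hA
  have hL : ContDiff ℝ 1 fun p : U × W => L p.1 := L.contDiff.comp contDiff_fst
  exact contDiff_const.mul ((((contDiff_const.mul (contDiff_const.mul hb)).add
    (contDiff_const.mul hK)).sub (contDiff_const.mul hL)).sub contDiff_const)

lemma form_add_smul (hb : ∀ A B, b A B = b B A) (A B : T) (t : ℝ) :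
    b (A + t • B) (A + t • B) = b A A + 2 * t * b A B + t ^ 2 * b B B := by
  simp only [map_add, map_smul, add_apply, smul_apply, smul_eq_mul, hb B A]
  ring

/-- Equilibrium of the flat state. -/
lemma flat_equilibrium (hb : ∀ A B, b A B = b B A) {u : U}
    (hu : ∀ v, plateEnergy S G b K L h u 0 ≤ plateEnergy S G b K L h v 0) (φ : U) :
    h * b (S u) (S φ) = h * L φ := by
  have key : h * b (S u) (S φ) - h * L φ = 0 := by
    -- The increment of the flat energy along t • φ is a quadratic polynomial in t; its linear
    -- coefficient is the Euler equation.
    refine eq_zero_of_quadratic_min (c₂ := h * (1 / 2 * b (S φ) (S φ))) fun t => ?_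
    have := hu (u + t • φ)
    have hS : S (u + t • φ) = S u + t • S φ := by simp
    have hL : L (u + t • φ) = L u + t * L φ := by simp
    simp only [plateEnergy, map_zero, smul_zero, add_zero, mul_zero, hS, hL,
      form_add_smul hb] at this
    linarith
  linarith

/-- Euler equation of the corrector. -/
lemma corrector_equilibrium (hb : ∀ A B, b A B = b B A) {B : T} {z : U}
    (hz : ∀ v, b (S z + B) (S z + B) ≤ b (S v + B) (S v + B)) (φ : U) :
    b (S z + B) (S φ) = 0 := by
  have key : 2 * b (S z + B) (S φ) = 0 := by
    refine eq_zero_of_quadratic_min (c₂ := b (S φ) (S φ)) fun t => ?_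
    have := hz (z + t • φ)
    have hS : S (z + t • φ) + B = (S z + B) + t • S φ := by
      rw [map_add, map_smul, add_right_comm]
    rw [hS, form_add_smul hb] at this
    linarith
  linarith

lemma hasFDerivAt_diag {F : Type*} [NormedAddCommGroup F] [NormedSpace ℝ F]
    (B : W →L[ℝ] W →L[ℝ] F) (w : W) :
    HasFDerivAt (fun v => B v v) (B w + B.flip w) w := by
  have := B.hasFDerivAt_of_bilinear (hasFDerivAt_id w) (hasFDerivAt_id w)
  refine this.congr_fderiv ?_
  ext ψ
  simp [ContinuousLinearMap.precompR, ContinuousLinearMap.precompL]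

lemma _root_.HasFDerivAt.bilinear_diag {X F : Type*} [NormedAddCommGroup X] [NormedSpace ℝ X]
    [NormedAddCommGroup F] [NormedSpace ℝ F] (B : W →L[ℝ] W →L[ℝ] F) {f : X → W} {f' : X →L[ℝ] W}
    {x : X} (hf : HasFDerivAt f f' x) :
    HasFDerivAt (fun y => B (f y) (f y)) ((B (f x) + B.flip (f x)).comp f') x :=
  (hasFDerivAt_diag B (f x)).comp x hf

/-- Value of the rescaled energy along the recovery family. -/
lemma rescaledPlateEnergy_recovery (hb : ∀ A B, b A B = b B A) {u : U}
    (hu : ∀ v, plateEnergy S G b K L h u 0 ≤ plateEnergy S G b K L h v 0) (z : U) (w : W)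
    {ε : ℝ} (hε : ε ≠ 0) :
    rescaledPlateEnergy S G b K L h u ε (u + ε ^ 2 • z, w) =
      1 / 2 * K w w + h / 2 * b (S u) (G w w) +
        ε ^ 2 * (h * (1 / 2 * b (S z + (1 / 2 : ℝ) • G w w) (S z + (1 / 2 : ℝ) • G w w))) := by
  -- The scaling ε² of the corrector matches that of the quadratic term in ε • w.
  have hA : S (u + ε ^ 2 • z) + (1 / 2 : ℝ) • G (ε • w) (ε • w) =
      S u + ε ^ 2 • (S z + (1 / 2 : ℝ) • G w w) := by
    simp only [map_add, map_smul, smul_apply]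
    module
  have e := flat_equilibrium hb hu z
  have hK : K (ε • w) (ε • w) = ε ^ 2 * K w w := by
    simp only [map_smul, smul_apply, smul_eq_mul]; ring
  have hL : L (u + ε ^ 2 • z) = L u + ε ^ 2 * L z := by simp
  have hbz : b (S u) (S z + (1 / 2 : ℝ) • G w w) = b (S u) (S z) + 1 / 2 * b (S u) (G w w) := by
    simp
  simp only [rescaledPlateEnergy]
  rw [plateEnergy, plateEnergy, hA, form_add_smul hb, hK, hL, hbz]
  simp only [map_zero, smul_zero, add_zero, mul_zero]
  rw [inv_mul_eq_iff_eq_mul₀ (pow_ne_zero 2 hε)]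
  -- Equilibrium tested with z removes h b(S u, S z) - h L z.
  linear_combination ε ^ 2 * e

/-- The differential of the rescaled energy along the recovery family of a critical point. -/
lemma hasFDerivAt_rescaledPlateEnergy_recovery (hb : ∀ A B, b A B = b B A) {u : U}
    (hu : ∀ v, plateEnergy S G b K L h u 0 ≤ plateEnergy S G b K L h v 0) {w : W}
    (hw : HasFDerivAt (fun v => 1 / 2 * K v v + h / 2 * b (S u) (G v v)) (0 : W →L[ℝ] ℝ) w)
    {z : U} (hz : ∀ v, b (S z + (1 / 2 : ℝ) • G w w) (S z + (1 / 2 : ℝ) • G w w) ≤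
      b (S v + (1 / 2 : ℝ) • G w w) (S v + (1 / 2 : ℝ) • G w w)) {ε : ℝ} (hε : ε ≠ 0) :
    HasFDerivAt (rescaledPlateEnergy S G b K L h u ε)
      (ε ^ 2 • (h / 2) • ((b (S z + (1 / 2 : ℝ) • G w w)).comp
        ((G w + G.flip w).comp (ContinuousLinearMap.snd ℝ U W)))) (u + ε ^ 2 • z, w) := by
  set B := S z + (1 / 2 : ℝ) • G w w with hB
  set p₀ : U × W := (u + ε ^ 2 • z, w) with hp₀
  have hcrit : ∀ ψ, 1 / 2 * (K w ψ + K ψ w) + h / 2 * b (S u) (G w ψ + G ψ w) = 0 := by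
    have h1 := ((hasFDerivAt_diag K w).const_mul (1 / 2)).add
      (((b (S u)).hasFDerivAt.comp w (hasFDerivAt_diag G w)).const_mul (h / 2))
    have h2 := h1.unique hw
    intro ψ
    have h3 := DFunLike.congr_fun h2 ψ
    simp only [add_apply, smul_apply, ContinuousLinearMap.comp_apply,
      ContinuousLinearMap.flip_apply, smul_eq_mul, zero_apply] at h3
    exact h3
  have hsnd : HasFDerivAt (fun p : U × W => p.2) (ContinuousLinearMap.snd ℝ U W) p₀ :=
    hasFDerivAt_snd
  have hfst : HasFDerivAt (fun p : U × W => p.1) (ContinuousLinearMap.fst ℝ U W) p₀ :=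
    hasFDerivAt_fst
  have hG : HasFDerivAt (fun p : U × W => G p.2 p.2) _ p₀ := hsnd.bilinear_diag G
  have hK : HasFDerivAt (fun p : U × W => K p.2 p.2) _ p₀ := hsnd.bilinear_diag K
  have hS : HasFDerivAt (fun p : U × W => S p.1) _ p₀ := S.hasFDerivAt.comp p₀ hfst
  have hL : HasFDerivAt (fun p : U × W => L p.1) _ p₀ := L.hasFDerivAt.comp p₀ hfst
  have hA := hS.fun_add (hG.fun_const_smul (ε ^ 2 / 2))
  have hval : S p₀.1 + (ε ^ 2 / 2) • G p₀.2 p₀.2 = S u + ε ^ 2 • B := by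
    simp only [hp₀, hB, map_add, map_smul]
    module
  have hq := hA.bilinear_diag b
  have htot := ((((hq.const_mul (1 / 2)).const_mul h).fun_add ((hK.const_mul (ε ^ 2)).const_mul
    (1 / 2))).fun_sub (hL.const_mul h)).sub_const (plateEnergy S G b K L h u 0)
  have hfin := htot.const_mul (ε ^ 2)⁻¹
  -- Bilinearity moves ε out of the arguments, so the differentiation is with respect to w itself.
  have hfun : rescaledPlateEnergy S G b K L h u ε = fun p : U × W =>
      (ε ^ 2)⁻¹ * (h * (1 / 2 * b (S p.1 + (ε ^ 2 / 2) • G p.2 p.2)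
        (S p.1 + (ε ^ 2 / 2) • G p.2 p.2)) + 1 / 2 * (ε ^ 2 * K p.2 p.2) - h * L p.1 -
        plateEnergy S G b K L h u 0) := by
    funext p
    have hA' : S p.1 + (1 / 2 : ℝ) • G (ε • p.2) (ε • p.2) =
        S p.1 + (ε ^ 2 / 2) • G p.2 p.2 := by
      simp only [map_smul, smul_apply]
      module
    have hK' : K (ε • p.2) (ε • p.2) = ε ^ 2 * K p.2 p.2 := by
      simp only [map_smul, smul_apply, smul_eq_mul]; ring
    rw [rescaledPlateEnergy, plateEnergy, hA', hK']
  rw [hfun]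
  refine hfin.congr_fderiv ?_
  refine ContinuousLinearMap.ext fun q => ?_
  obtain ⟨φ, ψ⟩ := q
  have e1 := flat_equilibrium hb hu φ
  have e2 := hcrit ψ
  have e3 : b B (S φ) = 0 := corrector_equilibrium hb hz φ
  rw [hval]
  have hp₂ : p₀.2 = w := rfl
  have hflip : b (S φ + (ε ^ 2 / 2) • (G w ψ + G ψ w)) (S u + ε ^ 2 • B) =
    b (S u + ε ^ 2 • B) (S φ + (ε ^ 2 / 2) • (G w ψ + G ψ w)) := hb _ _
  simp only [smul_apply, sub_apply, add_apply, ContinuousLinearMap.comp_apply,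
    ContinuousLinearMap.flip_apply, ContinuousLinearMap.coe_fst', ContinuousLinearMap.coe_snd',
    smul_eq_mul, hp₂, hflip]
  rw [inv_mul_eq_iff_eq_mul₀ (pow_ne_zero 2 hε)]
  simp only [map_add, map_smul, add_apply, smul_apply, smul_eq_mul] at e1 e2 ⊢
  -- The three Euler equations, for u, w and z, multiplied by ε² where they enter at order 0.
  linear_combination e1 + ε ^ 2 * e2 + h * ε ^ 2 * e3

end Abstract

/-! ### The Föppl–von Kármán energies as plate energies -/

lemma TensorField.Represents.add_half_smul {Ω : Set Plane} {A B : TensorField Ω}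
    {a b : Plane → Mat} (ha : A.Represents a) (hb : B.Represents b) :
    (A + (1 / 2 : ℝ) • B).Represents fun x => a x + (1 / 2 : ℝ) • b x := by
  intro i j
  change ⇑(A i j + (1 / 2 : ℝ) • B i j) =ᵐ[_] _
  filter_upwards [Lp.coeFn_add (A i j) ((1 / 2 : ℝ) • B i j), Lp.coeFn_smul (1 / 2 : ℝ) (B i j),
    ha i j, hb i j] with x h1 h2 h3 h4
  rw [h1, Pi.add_apply, h2, Pi.smul_apply, h3, h4, Matrix.add_apply, Matrix.smul_apply]

/-- The bending form, on a subspace of `H²(Ω)`. -/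
def bendingForm {Ω : Set Plane} (V : Submodule ℝ (H2 Ω)) (E ν h : ℝ) : V →L[ℝ] V →L[ℝ] ℝ :=
  (h ^ 3 / 12) • (elasticForm Ω E ν).bilinearComp ((hessianL Ω).comp V.subtypeL)
    ((hessianL Ω).comp V.subtypeL)

lemma bendingEnergy_eq {Ω : Set Plane} (V : Submodule ℝ (H2 Ω)) (E ν h : ℝ) (w : V) :
    bendingEnergy E ν h (w : H2 Ω) = 1 / 2 * bendingForm V E ν h w w := by
  rw [bendingEnergy, integral_J E ν (hessianL_represents (w : H2 Ω))]
  simp only [bendingForm, smul_apply, ContinuousLinearMap.bilinearComp_apply,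
    ContinuousLinearMap.comp_apply, Submodule.subtypeL_apply, smul_eq_mul]
  ring

lemma Q_eq {Ω : Set Plane} {G : H2 Ω →L[ℝ] H2 Ω →L[ℝ] TensorField Ω}
    (hG : ∀ w : H2 Ω, (G w w).Represents (gradTensor w)) (E ν : ℝ) (w : H2 Ω) (z : H1Vec Ω) :
    Q E ν w z = 1 / 2 * elasticForm Ω E ν (strainL Ω z + (1 / 2 : ℝ) • G w w)
      (strainL Ω z + (1 / 2 : ℝ) • G w w) :=
  integral_J E ν ((strainL_represents z).add_half_smul (hG w))

/-- The product of gradients, on a subspace of `H²(Ω)`. -/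
def restrictForm {Ω : Set Plane} (V : Submodule ℝ (H2 Ω))
    (G : H2 Ω →L[ℝ] H2 Ω →L[ℝ] TensorField Ω) : V →L[ℝ] V →L[ℝ] TensorField Ω :=
  G.bilinearComp V.subtypeL V.subtypeL

lemma fvkEnergy_eq {Ω : Set Plane} {G : H2 Ω →L[ℝ] H2 Ω →L[ℝ] TensorField Ω}
    (hG : ∀ w : H2 Ω, (G w w).Represents (gradTensor w)) {f : Lp Plane 2 (bdryMeasure Ω)}
    {L : H1Vec Ω →L[ℝ] ℝ} (hL : ∀ u, L u = loadWork f u) (V : Submodule ℝ (H2 Ω))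
    (E ν h : ℝ) (u : H1Vec Ω) (w : V) :
    fvkEnergy E ν h f u (w : H2 Ω) = plateEnergy (strainL Ω) (restrictForm V G)
      (elasticForm Ω E ν) (bendingForm V E ν h) L h u w := by
  rw [fvkEnergy, plateEnergy, bendingEnergy_eq, hL]
  have hQ : membraneEnergy E ν h u (w : H2 Ω) = h * Q E ν (w : H2 Ω) u := rfl
  rw [hQ, Q_eq hG]
  rfl

lemma rescaledEnergy_eq {Ω : Set Plane} {G : H2 Ω →L[ℝ] H2 Ω →L[ℝ] TensorField Ω}
    (hG : ∀ w : H2 Ω, (G w w).Represents (gradTensor w)) {f : Lp Plane 2 (bdryMeasure Ω)}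
    {L : H1Vec Ω →L[ℝ] ℝ} (hL : ∀ u, L u = loadWork f u) (Γ : Set Plane) (i : Fin 3)
    {E ν h : ℝ} {u : H1Vec Ω} (hu : IsFlatMinimizer E ν h f u) (ε : ℝ) (v : H1Vec Ω)
    (w : admissible Ω Γ i) :
    rescaledEnergy Γ i E ν h f ε v (w : H2 Ω) =
      ((rescaledPlateEnergy (strainL Ω) (restrictForm (admissible Ω Γ i) G)
        (elasticForm Ω E ν) (bendingForm (admissible Ω Γ i) E ν h) L h u ε (v, w) : ℝ) :
          EReal) := by
  -- The minimizer makes the range bounded below, so the real infimum is its value and not the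
  -- default 0.
  have hmin : ⨅ v, flatEnergy E ν h f v = fvkEnergy E ν h f u ((0 : admissible Ω Γ i) : H2 Ω) := by
    have hle : ∀ v, flatEnergy E ν h f u ≤ flatEnergy E ν h f v := fun v => hu (mem_univ v)
    refine le_antisymm (ciInf_le ⟨flatEnergy E ν h f u, ?_⟩ u) (le_ciInf hle)
    rintro _ ⟨v, rfl⟩
    exact hle v
  have hmem : ε • (w : H2 Ω) ∈ admissible Ω Γ i := (ε • w).2
  rw [rescaledEnergy, fvkEnergyBC, if_pos hmem, hmin, rescaledPlateEnergy,
    ← fvkEnergy_eq hG hL, ← fvkEnergy_eq hG hL, EReal.coe_mul, EReal.coe_sub]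
  rfl

lemma limitEnergy_eq {Ω : Set Plane} {G : H2 Ω →L[ℝ] H2 Ω →L[ℝ] TensorField Ω}
    (hG : ∀ w : H2 Ω, (G w w).Represents (gradTensor w)) {f : Lp Plane 2 (bdryMeasure Ω)}
    (Γ : Set Plane) (i : Fin 3) {E ν h : ℝ} {u : H1Vec Ω} (hu : IsFlatMinimizer E ν h f u)
    (w : admissible Ω Γ i) :
    limitEnergy Γ i E ν h f u (w : H2 Ω) =
      ((1 / 2 * bendingForm (admissible Ω Γ i) E ν h w w + h / 2 * elasticForm Ω E ν
        (strainL Ω u) (restrictForm (admissible Ω Γ i) G w w) : ℝ) : EReal) := by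
  rw [limitEnergy, if_pos ⟨hu, w.2⟩, bendingEnergy_eq,
    integral_ddot_J' E ν (strainL_represents u) (hG w)]
  rfl

end FvK

end

theorem theorem2p3
    (Ω : Set FvK.Plane) (hopen : IsOpen Ω) (hconn : IsConnected Ω)
    (hbdd : Bornology.IsBounded Ω) (hlip : FvK.HasLipschitzBoundary Ω)
    (Γ : Set FvK.Plane) (hΓ : Γ ⊆ frontier Ω) (hΓmeas : MeasurableSet Γ)
    (hΓpos : 0 < (MeasureTheory.Measure.hausdorffMeasure 1 : MeasureTheory.Measure FvK.Plane) Γ)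
    (E ν h : ℝ) (hE : 0 < E) (hν : -1 < ν) (hν' : ν < 1 / 2) (hh : 0 < h)
    (f : MeasureTheory.Lp FvK.Plane 2 (FvK.bdryMeasure Ω)) (hf : FvK.Equilibrated f)
    (i : Fin 3)
    (u : FvK.H1Vec Ω) (hu : FvK.IsFlatMinimizer E ν h f u)
    (w : FvK.admissible Ω Γ i)
    (hw : FvK.IsCriticalPoint
      (fun v : FvK.admissible Ω Γ i => (FvK.limitEnergy Γ i E ν h f u v).toReal) w)
    (z : FvK.H1Vec Ω) (hz : IsMinOn (FvK.Q E ν (w : FvK.H2 Ω)) Set.univ z) :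
    FvK.IsUniformPalaisSmale
      (fun (ε : ℝ) (p : FvK.H1Vec Ω × FvK.admissible Ω Γ i) =>
        (FvK.rescaledEnergy Γ i E ν h f ε p.1 p.2).toReal)
      (fun ε => (u + ε ^ 2 • z, w)) ∧
    Filter.Tendsto
      (fun ε : ℝ => FvK.rescaledEnergy Γ i E ν h f ε (u + ε ^ 2 • z) (w : FvK.H2 Ω))
      (nhdsWithin 0 (Set.Ioi 0)) (nhds (FvK.limitEnergy Γ i E ν h f u (w : FvK.H2 Ω))) := by
  obtain ⟨G, hG⟩ := FvK.exists_gradTensorL hopen hbdd hlip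
  obtain ⟨L, hL⟩ := FvK.exists_loadWorkL f
  -- On the admissible subspace all energies are finite, so `EReal.toReal` loses nothing.
  simp only [FvK.rescaledEnergy_eq hG hL Γ i hu, FvK.limitEnergy_eq hG Γ i hu,
    EReal.toReal_coe] at hw ⊢
  have hu' : ∀ v, FvK.plateEnergy (FvK.strainL Ω) (FvK.restrictForm (FvK.admissible Ω Γ i) G)
      (FvK.elasticForm Ω E ν) (FvK.bendingForm (FvK.admissible Ω Γ i) E ν h) L h u 0 ≤
      FvK.plateEnergy (FvK.strainL Ω) (FvK.restrictForm (FvK.admissible Ω Γ i) G)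
      (FvK.elasticForm Ω E ν) (FvK.bendingForm (FvK.admissible Ω Γ i) E ν h) L h v 0 := by
    intro v
    rw [← FvK.fvkEnergy_eq hG hL, ← FvK.fvkEnergy_eq hG hL]
    exact hu (Set.mem_univ v)
  have hz' : ∀ v, FvK.elasticForm Ω E ν (FvK.strainL Ω z + (1 / 2 : ℝ) • G w w)
      (FvK.strainL Ω z + (1 / 2 : ℝ) • G w w) ≤
      FvK.elasticForm Ω E ν (FvK.strainL Ω v + (1 / 2 : ℝ) • G w w)
      (FvK.strainL Ω v + (1 / 2 : ℝ) • G w w) := by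
    intro v
    have h1 : FvK.Q E ν (w : FvK.H2 Ω) z ≤ FvK.Q E ν (w : FvK.H2 Ω) v := hz (Set.mem_univ v)
    rw [FvK.Q_eq hG, FvK.Q_eq hG] at h1
    linarith
  have hsymm := FvK.elasticForm_symm (Ω := Ω) E ν
  have hval := fun {ε : ℝ} (hε : ε ≠ 0) => FvK.rescaledPlateEnergy_recovery hsymm hu' z w hε
  have hder := fun {ε : ℝ} (hε : ε ≠ 0) =>
    FvK.hasFDerivAt_rescaledPlateEnergy_recovery hsymm hu' hw hz' hε
  have hsq : Tendsto (fun ε : ℝ => ε ^ 2) (𝓝[>] 0) (𝓝 0) := by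
    have : Tendsto (fun ε : ℝ => ε ^ 2) (𝓝 0) (𝓝 (0 ^ 2)) := (continuous_pow 2).tendsto 0
    rw [zero_pow two_ne_zero] at this
    exact this.mono_left nhdsWithin_le_nhds
  refine ⟨⟨fun ε _ => FvK.contDiff_rescaledPlateEnergy u ε, ?_, ?_⟩, ?_⟩
  · set a := 1 / 2 * FvK.bendingForm (FvK.admissible Ω Γ i) E ν h w w + h / 2 *
      FvK.elasticForm Ω E ν (FvK.strainL Ω u) (FvK.restrictForm (FvK.admissible Ω Γ i) G w w)
    set c := h * (1 / 2 * FvK.elasticForm Ω E ν (FvK.strainL Ω z + (1 / 2 : ℝ) • G w w)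
      (FvK.strainL Ω z + (1 / 2 : ℝ) • G w w)) with hc
    refine ⟨|a| + |c| + 1, by positivity, fun ε hε => ?_⟩
    rw [hval hε.1.ne']
    have h1 : ε ^ 2 ≤ 1 := pow_le_one₀ hε.1.le hε.2
    have h2 : ε ^ 2 * c ≤ |c| :=
      (mul_le_mul_of_nonneg_left (le_abs_self c) (sq_nonneg ε)).trans
        (mul_le_of_le_one_left (abs_nonneg c) h1)
    have h3 := le_abs_self a
    change a + ε ^ 2 * c ≤ _
    linarith
  -- The differential is ε² times a functional that does not depend on ε.
  · have hlim := hsq.mul_const ‖(h / 2) • ((FvK.elasticForm Ω E ν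
      (FvK.strainL Ω z + (1 / 2 : ℝ) • FvK.restrictForm (FvK.admissible Ω Γ i) G w w)).comp
        ((FvK.restrictForm (FvK.admissible Ω Γ i) G w +
          (FvK.restrictForm (FvK.admissible Ω Γ i) G).flip w).comp
            (ContinuousLinearMap.snd ℝ (FvK.H1Vec Ω) (FvK.admissible Ω Γ i))))‖
    rw [zero_mul] at hlim
    refine hlim.congr' ?_
    filter_upwards [self_mem_nhdsWithin] with ε hε
    rw [(hder (ne_of_gt hε)).fderiv, norm_smul (ε ^ 2), Real.norm_of_nonneg (sq_nonneg ε)]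
  · refine (continuous_coe_real_ereal.tendsto _).comp ?_
    have hlim := (hsq.mul_const (h * (1 / 2 * FvK.elasticForm Ω E ν
      (FvK.strainL Ω z + (1 / 2 : ℝ) • FvK.restrictForm (FvK.admissible Ω Γ i) G w w)
      (FvK.strainL Ω z + (1 / 2 : ℝ) • FvK.restrictForm (FvK.admissible Ω Γ i) G w w)))).const_add
      (1 / 2 * FvK.bendingForm (FvK.admissible Ω Γ i) E ν h w w + h / 2 *
        FvK.elasticForm Ω E ν (FvK.strainL Ω u) (FvK.restrictForm (FvK.admissible Ω Γ i) G w w))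
    rw [zero_mul, add_zero] at hlim
    refine hlim.congr' ?_
    filter_upwards [self_mem_nhdsWithin] with ε hε
    exact (hval (ne_of_gt hε)).symm
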